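/- For every $I\in\mathbb N$ let a matched data set with $I$ matched sets be given. Set $i$ has $n_i$ units, of which $m_i$ are treated, where $\min\{m_i,n_i-m_i\}=1$; put $N=\sum_{i=1}^I n_i$ and $w_i=In_i/N$. Unit $j$ of set $i$ has fixed observed covariates $\mathbf x_{ij}\in\mathbb R^K$ (not assumed equal within a set), fixed potential outcomes $Y_{ij}(1),Y_{ij}(0)\in\mathbb R$, and propensity score $e_{ij}=e(\mathbf x_{ij})\in(0,1)$. All these quantities may depend on $I$. Let $Z_{ij}\in\{0,1\}$ be the treatment indicators, $Y_{ij}=Z_{ij}Y_{ij}(1)+(1-Z_{ij})Y_{ij}(0)$, $\mathbf Z_i=(Z_{i1},\dots,Z_{in_i})$, $\mathcal Z_i=\{\mathbf z\in\{0,1\}^{n_i}:\sum_j z_j=m_i\}$, and let $\mathcal Z$ be the event that $\mathbf Z_i\in\mathcal Z_i$ for all $i$. Assume that $\mathbf Z_1,\dots,\mathbf Z_I$ are independent (independence across matched sets), and that within each set, given covariates and potential outcomes, the units are treated independently with probabilities $e_{ij}$ (no unobserved covariates). The post-matching probabilities are $$p_{ij}=\frac{e_{ij}\prod_{k\ne j}(1-e_{ik})}{\sum_{j'}e_{ij'}\prod_{k\ne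 j'}(1-e_{ik})}\ \text{ if } m_i=1,\qquad p_{ij}=1-\frac{(1-e_{ij})\prod_{k\ne j}e_{ik}}{\sum_{j'}(1-e_{ij'})\prod_{k\ne j'}e_{ik}}\ \text{ if } m_i>1.$$ Let $\lambda=N^{-1}\sum_{i}\sum_{j}\{Y_{ij}(1)-Y_{ij}(0)\}$ be the sample average treatment effect, and let $$\widehat\lambda_*=\sum_{i=1}^I\frac{n_i}{N}\widehat\lambda_{*,i},\qquad \widehat\lambda_{*,i}=\frac1{n_i}\sum_{j=1}^{n_i}\Big(\frac{Z_{ij}Y_{ij}}{p_{ij}}-\frac{(1-Z_{ij})Y_{ij}}{1-p_{ij}}\Big)$$ be the oracle IPPW estimator. Let $L$ be fixed, and for each $I$ let $Q=(q_{il})$ be a non-random real $I\times L$ matrix. Put $H_Q=Q(Q^TQ)^{-1}Q^T$ with diagonal entries $h_{Qii}$, $y_i=\widehat\lambda_{*,i}/\sqrt{1-h_{Qii}}$, $\mathbf y=(y_1,\dots,y_I)$, $W=\mathrm{diag}(w_1,\dots,w_I)$, and, with $\mathcal I$ the identity matrix, $S_*^2(Q)=I^{-2}\,\mathbf yW(\mathcal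 I-H_Q)W\mathbf y^T$ and $S_*(Q)=\sqrt{S_*^2(Q)}$. Let $\widehat\lambda_{*,i}^{+}$ and $\widehat\lambda_{*,i}^{-}$ be the maximum and the minimum of $\widehat\lambda_{*,i}$ over $\mathbf Z_i\in\mathcal Z_i$, $M_i=\widehat\lambda_{*,i}^+-\widehat\lambda_{*,i}^-$, $\widetilde M_i=w_iM_i$, $l_i=\min_{\mathbf z\in\mathcal Z_i}\mathrm{pr}(\mathbf Z_i=\mathbf z\mid\mathbf Z_i\in\mathcal Z_i)$, $\mu_i=E(\widehat\lambda_{*,i}\mid\mathcal Z)$ and $\nu_i^2=\mathrm{var}(\widehat\lambda_{*,i}\mid\mathcal Z)$. Assume: 1. $\max_{i}\widetilde M_i^2/\sum_{i}l_i^3\widetilde M_i^2\to0$ as $I\to\infty$. 2. There is $C_1<\infty$ such that for all $I,i,l$: $n_i\le C_1$ and $|q_{il}|\le C_1$. 3. There is $C_2<\infty$ such that for all $I$: $I^{-1}\sum_iM_i^4\le C_2$, $I^{-1}\sum_i(\widehat\lambda_{*,i}^+)^4\le C_2$ and $I^{-1}\sum_i(\widehat\lambda_{*,i}^-)^4\le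 C_2$. 4. As $I\to\infty$: (i) $I^{-1}\sum_iw_i\mu_i$, $I^{-1}\sum_iw_i^2\mu_i$ and $I^{-1}\sum_iw_i^2\mu_i^2$ converge to finite values; (ii) $I^{-1}\sum_iw_i^2\nu_i^2$ converges to a finite positive value; (iii) for each $l$, $I^{-1}\sum_iw_i\mu_iq_{il}$ converges to a finite value; (iv) $I^{-1}Q^TQ$ converges to an invertible matrix. Then, for every $\alpha\in(0,1/2)$, with $\Phi$ the standard normal distribution function, the limit below exists and $$\lim_{I\to\infty}\mathrm{pr}\Big(\widehat\lambda_*-\Phi^{-1}(1-\alpha/2)\,S_*(Q)\le\lambda\le\widehat\lambda_*+\Phi^{-1}(1-\alpha/2)\,S_*(Q)\ \Big|\ \mathcal Z\Big)\ge1-\alpha .$$ -/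

import Mathlib

open MeasureTheory ProbabilityTheory Filter Topology
open scoped Matrix

noncomputable section

/-- A (possibly inexactly) matched data set with `I` matched sets and `K` observed covariates.
Set `i` has `n i` units, `m i` of them treated, with either exactly one treated unit or exactly
one control. Covariates and potential outcomes are fixed numbers. The covariates of two units of
the same set need not agree. `propensity` is the propensity score as a function of the observed
covariates; it lies strictly between 0 and 1 at every unit. -/
structure MatchedStudy (I K : ℕ) where
  n : Fin I → ℕ
  m : Fin I → ℕ
  min_eq_one : ∀ i, min (m i) (n i - m i) = 1
  x : (i : Fin I) → Fin (n i) → (Fin K → ℝ)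
  Y1 : (i : Fin I) → Fin (n i) → ℝ
  Y0 : (i : Fin I) → Fin (n i) → ℝ
  propensity : (Fin K → ℝ) → ℝ
  propensity_pos : ∀ i j, 0 < propensity (x i j)
  propensity_lt_one : ∀ i j, propensity (x i j) < 1

namespace MatchedStudy

variable {I K : ℕ} (S : MatchedStudy I K)

/-- Treatment assignments: `z i j = true` if unit `j` of set `i` is treated. -/
abbrev Assignment : Type := (i : Fin I) → Fin (S.n i) → Bool

/-- The collection of possible within-set assignments of set `i` (exactly `m i` treated). -/
def admissible (i : Fin I) : Finset (Fin (S.n i) → Bool) :=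
  Finset.univ.filter fun z => (Finset.univ.filter fun j => z j = true).card = S.m i

/-- The event that every matched set `i` has exactly `m i` treated units. -/
def matchedEvent : Set S.Assignment := {z | ∀ i, z i ∈ S.admissible i}

theorem admissible_nonempty (i : Fin I) : (S.admissible i).Nonempty := by
  have h := S.min_eq_one i
  have hle : S.m i ≤ (Finset.univ : Finset (Fin (S.n i))).card := by
    rw [Finset.card_univ, Fintype.card_fin]; omega
  obtain ⟨t, -, ht⟩ := Finset.exists_subset_card_eq hle
  refine ⟨fun j => decide (j ∈ t), ?_⟩
  simp [admissible, ht]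

/-- Total number of units. -/
def N : ℕ := ∑ i, S.n i

/-- Matched set weights `I n_i / N`. -/
def w (i : Fin I) : ℝ := (I : ℝ) * S.n i / S.N

/-- The sample average treatment effect. -/
def sate : ℝ := (S.N : ℝ)⁻¹ * ∑ i, ∑ j, (S.Y1 i j - S.Y0 i j)

/-- The propensity score of unit `j` of set `i`. -/
def e (i : Fin I) (j : Fin (S.n i)) : ℝ := S.propensity (S.x i j)

/-- The post-matching treatment probability of unit `j` of set `i`, in terms of the propensity
scores of the units of set `i`. -/
def p (i : Fin I) (j : Fin (S.n i)) : ℝ :=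
  if S.m i = 1 then
    (S.e i j * ∏ k ∈ Finset.univ.erase j, (1 - S.e i k)) /
      ∑ j', S.e i j' * ∏ k ∈ Finset.univ.erase j', (1 - S.e i k)
  else
    1 - ((1 - S.e i j) * ∏ k ∈ Finset.univ.erase j, S.e i k) /
      ∑ j', (1 - S.e i j') * ∏ k ∈ Finset.univ.erase j', S.e i k

/-- The treatment indicator as a real number. -/
def ind (b : Bool) : ℝ := if b then 1 else 0

/-- Observed outcome of unit `j` of set `i` under the within-set assignment `z`. -/
def Yobs (i : Fin I) (z : Fin (S.n i) → Bool) (j : Fin (S.n i)) : ℝ :=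
  ind (z j) * S.Y1 i j + (1 - ind (z j)) * S.Y0 i j

/-- The oracle IPPW estimator of set `i`. -/
def ippwSet (i : Fin I) (z : Fin (S.n i) → Bool) : ℝ :=
  (1 / (S.n i : ℝ)) * ∑ j,
    (ind (z j) * S.Yobs i z j / S.p i j - (1 - ind (z j)) * S.Yobs i z j / (1 - S.p i j))

/-- The oracle IPPW estimator. -/
def ippw (z : S.Assignment) : ℝ := ∑ i, ((S.n i : ℝ) / S.N) * S.ippwSet i (z i)

/-- Largest possible value of the estimator of set `i`. -/
def ippwMax (i : Fin I) : ℝ := (S.admissible i).sup' (S.admissible_nonempty i) (S.ippwSet i)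

/-- Smallest possible value of the estimator of set `i`. -/
def ippwMin (i : Fin I) : ℝ := (S.admissible i).inf' (S.admissible_nonempty i) (S.ippwSet i)

/-- Range of the estimator of set `i`. -/
def M (i : Fin I) : ℝ := S.ippwMax i - S.ippwMin i

/-- Weighted range of the estimator of set `i`. -/
def Mtilde (i : Fin I) : ℝ := S.w i * S.M i

section Law

variable (P : Measure S.Assignment)

/-- The law of the treatment assignments conditional on the matched structure. -/
def condLaw : Measure S.Assignment := P[|S.matchedEvent]

/-- The smallest probability of a possible assignment of set `i`, conditional on the number of
treated units of this set. -/
def l (i : Fin I) : ℝ :=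
  (S.admissible i).inf' (S.admissible_nonempty i) fun z =>
    (P[|{a : S.Assignment | a i ∈ S.admissible i}]).real {a | a i = z}

/-- Conditional mean of the estimator of set `i`. -/
def mu (i : Fin I) : ℝ := ∫ a, S.ippwSet i (a i) ∂(S.condLaw P)

/-- Conditional variance of the estimator of set `i`. -/
def nuSq (i : Fin I) : ℝ := Var[fun a => S.ippwSet i (a i); S.condLaw P]

/-- The treatment assignments of different matched sets are independent. -/
def IndependentSets : Prop := iIndepFun (fun (i : Fin I) (a : S.Assignment) => a i) P

/-- No unobserved covariates: with covariates and potential outcomes held fixed, the units of a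
matched set receive treatment independently of each other, each with probability given by the
propensity score at its observed covariates. (This is before conditioning on the number of
treated units.) -/
def NoUnobservedCovariates : Prop :=
  ∀ (i : Fin I) (z : Fin (S.n i) → Bool),
    P.real {a : S.Assignment | a i = z} = ∏ j, if z j then S.e i j else 1 - S.e i j

end Law

section Variance

variable {L : ℕ} (Q : Matrix (Fin I) (Fin L) ℝ)

/-- The hat matrix of `Q`. -/
def hat {I L : ℕ} (Q : Matrix (Fin I) (Fin L) ℝ) : Matrix (Fin I) (Fin I) ℝ :=
  Q * (Qᵀ * Q)⁻¹ * Qᵀ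

/-- The leverage-rescaled estimators of the matched sets. -/
def y (z : S.Assignment) (i : Fin I) : ℝ := S.ippwSet i (z i) / √(1 - hat Q i i)

/-- The diagonal matrix of the matched set weights. -/
def W : Matrix (Fin I) (Fin I) ℝ := Matrix.diagonal S.w

/-- The regression-based variance estimator. -/
def varEst (z : S.Assignment) : ℝ :=
  ((I : ℝ) ^ 2)⁻¹ * ((S.y Q z ᵥ* (S.W * (1 - hat Q) * S.W)) ⬝ᵥ S.y Q z)

/-- The Wald-type interval with critical value `q`. -/
def waldCI (q : ℝ) (z : S.Assignment) : Set ℝ :=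
  Set.Icc (S.ippw z - q * √(S.varEst Q z)) (S.ippw z + q * √(S.varEst Q z))

end Variance

end MatchedStudy

/-- The quantile function of the standard normal distribution. -/
def stdNormalQuantile (t : ℝ) : ℝ := sInf {s : ℝ | t ≤ cdf (gaussianReal 0 1) s}

section Conditions

variable {K L : ℕ} (S : (I : ℕ) → MatchedStudy I K) (P : (I : ℕ) → Measure (S I).Assignment)
  (Q : (I : ℕ) → Matrix (Fin I) (Fin L) ℝ)

/-- No extreme matched sets. -/
def NoExtremeSets : Prop :=
  Tendsto (fun I => (⨆ i, (S I).Mtilde i ^ 2) / ∑ i, (S I).l (P I) i ^ 3 * (S I).Mtilde i ^ 2)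
    atTop (𝓝 0)

/-- Bounded matched sets and bounded entries of the design matrix. -/
def BoundedSetsAndDesign : Prop :=
  ∃ C : ℝ, ∀ (I : ℕ) (i : Fin I), ((S I).n i : ℝ) ≤ C ∧ ∀ k, |Q I i k| ≤ C

/-- Bounded fourth moments. -/
def BoundedFourthMoments : Prop :=
  ∃ C : ℝ, ∀ I : ℕ,
    (I : ℝ)⁻¹ * ∑ i, (S I).M i ^ 4 ≤ C ∧
    (I : ℝ)⁻¹ * ∑ i, (S I).ippwMax i ^ 4 ≤ C ∧
    (I : ℝ)⁻¹ * ∑ i, (S I).ippwMin i ^ 4 ≤ C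

/-- Convergence of finite-population means. -/
structure ConvergentMeans : Prop where
  mean : ∃ c, Tendsto (fun I : ℕ => (I : ℝ)⁻¹ * ∑ i, (S I).w i * (S I).mu (P I) i) atTop (𝓝 c)
  mean_sq_weight :
    ∃ c, Tendsto (fun I : ℕ => (I : ℝ)⁻¹ * ∑ i, (S I).w i ^ 2 * (S I).mu (P I) i) atTop (𝓝 c)
  mean_sq :
    ∃ c, Tendsto (fun I : ℕ => (I : ℝ)⁻¹ * ∑ i, (S I).w i ^ 2 * (S I).mu (P I) i ^ 2) atTop (𝓝 c)
  variance :
    ∃ c, 0 < c ∧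
      Tendsto (fun I : ℕ => (I : ℝ)⁻¹ * ∑ i, (S I).w i ^ 2 * (S I).nuSq (P I) i) atTop (𝓝 c)
  mean_design : ∀ k : Fin L,
    ∃ c, Tendsto (fun I : ℕ => (I : ℝ)⁻¹ * ∑ i, (S I).w i * (S I).mu (P I) i * Q I i k) atTop (𝓝 c)
  design : ∃ Qlim : Matrix (Fin L) (Fin L) ℝ, IsUnit Qlim ∧
    Tendsto (fun I : ℕ => (I : ℝ)⁻¹ • ((Q I)ᵀ * Q I)) atTop (𝓝 Qlim)

end Conditions

end

/-!
Write `T = √I (λ̂ - λ)` for the rescaled error of the oracle estimator. The interval covers `λ`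
exactly when `|T| ≤ q √(I S²)`, with `q` the normal quantile and `S²` the variance estimator, so the
claim follows from the joint limit of `T` and `I S²`.

* Conditionally on the matched structure the sets are independent (`condLaw_eq_pi`), and the
  post-matching probabilities are the conditional treatment probabilities (`sum_admissible_ind`).
  Hence each set estimator is unbiased for the average effect in its set (`mu_eq`), and `T` is a
  centred sum of independent terms.
* The largest and the smallest value of a set estimator each have probability at least `l i`, so
  `l i * M i ^ 2 ≤ 4 ν_i²` (`l_mul_M_sq_le_nuSq`). With the assumption on extreme sets, every
  summand of `T` is then bounded by a sequence tending to zero (`tendsto_inv_mul_iSup_Mtilde_sq`),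
  and a triangular-array central limit theorem (`tendsto_map_sum_gaussianReal`), proved with
  characteristic functions and Lévy's theorem, gives `T → N(0, v)`, where `v` is the limit of the
  averages of `w_i² ν_i²`.
* `I S²` is an average of squares minus a quadratic form in the `L` averages of the set estimators
  against the columns of `Q` (`mul_varEst_eq`). The leverages are `O(1/I)`, so the rescaling by
  `1 / √(1 - h)` is negligible, and the weak law of large numbers gives
  `I S² → v + m - cᵀ G⁻¹ c` in probability, with `m` and `c` the limits of the averages of
  `w_i² μ_i²` and `w_i μ_i q_i`, and `G` that of `QᵀQ / I`. The term `m - cᵀ G⁻¹ c` is a limit of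
  average squared least squares residuals, hence nonnegative (`dotProduct_inv_mulVec_le`), so the
  limit `s` is at least `v` (`exists_tendstoInProb_mul_varEst`).

By Slutsky (`tendsto_measureReal_abs_le`) the coverage probability tends to
`N(0, v)([-q √s, q √s])`, which is at least `N(0, 1)([-q, q]) ≥ 1 - α` (`le_gaussianReal_Icc`).
-/

noncomputable section

/-! ### A central limit theorem for bounded triangular arrays -/

lemma norm_prod_sub_prod_le_sum {ι 𝕜 : Type*} [NormedField 𝕜] (s : Finset ι) (f g : ι → 𝕜)
    (hf : ∀ i ∈ s, ‖f i‖ ≤ 1) (hg : ∀ i ∈ s, ‖g i‖ ≤ 1) :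
    ‖∏ i ∈ s, f i - ∏ i ∈ s, g i‖ ≤ ∑ i ∈ s, ‖f i - g i‖ := by
  classical
  induction s using Finset.induction_on with
  | empty => simp
  | insert a s ha ih =>
    rw [Finset.prod_insert ha, Finset.prod_insert ha, Finset.sum_insert ha]
    have e : f a * ∏ i ∈ s, f i - g a * ∏ i ∈ s, g i
        = (f a - g a) * ∏ i ∈ s, f i + g a * (∏ i ∈ s, f i - ∏ i ∈ s, g i) := by ring
    have h1 : ‖∏ i ∈ s, f i‖ ≤ 1 := by
      rw [norm_prod]
      exact Finset.prod_le_one (fun _ _ => norm_nonneg _)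
        fun i hi => hf i (Finset.mem_insert_of_mem hi)
    have h2 := ih (fun i hi => hf i (Finset.mem_insert_of_mem hi))
      fun i hi => hg i (Finset.mem_insert_of_mem hi)
    have h3 := hg a (Finset.mem_insert_self a s)
    rw [e]
    refine (norm_add_le _ _).trans ?_
    rw [norm_mul, norm_mul]
    gcongr
    · exact mul_le_of_le_one_right (norm_nonneg _) h1
    · exact (mul_le_of_le_one_left (norm_nonneg _) h3).trans h2

/-- The error of the quadratic Taylor expansion of `exp (i x)`. -/
lemma norm_exp_mul_I_sub_taylor_le {x : ℝ} (hx : |x| ≤ 1) :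
    ‖Complex.exp (x * Complex.I) - (1 + x * Complex.I - ((x ^ 2 / 2 : ℝ) : ℂ))‖ ≤ |x| ^ 3 := by
  have hn : ‖(x : ℂ) * Complex.I‖ = |x| := by simp
  have h := Complex.exp_bound (x := x * Complex.I) (by rw [hn]; exact hx) (n := 3) (by norm_num)
  rw [hn] at h
  have e : ∑ m ∈ Finset.range 3, ((x : ℂ) * Complex.I) ^ m / (m.factorial : ℂ)
      = 1 + x * Complex.I - ((x ^ 2 / 2 : ℝ) : ℂ) := by
    simp [Finset.sum_range_succ, Nat.factorial, mul_pow, Complex.I_sq]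
    ring
  rw [e] at h
  refine h.trans (mul_le_of_le_one_right (by positivity) ?_)
  norm_num [Nat.factorial]

section CharFun

variable {Ω : Type*} {mΩ : MeasurableSpace Ω} {μ : Measure Ω} [IsProbabilityMeasure μ]

/-- For a small centred variable the characteristic function is that of the normal law with the same
variance, up to a small multiple of the variance: both agree with `1 - t² Var X / 2` to this
order. -/
lemma norm_charFun_map_sub_exp_le {X : Ω → ℝ} (hX : AEMeasurable X μ) {b : ℝ}
    (hb : ∀ᵐ ω ∂μ, |X ω| ≤ b) (h0 : μ[X] = 0) {t : ℝ} (ht : |t| * b ≤ 1) :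
    ‖charFun (μ.map X) t - (Real.exp (-(t ^ 2 * Var[X; μ] / 2)) : ℂ)‖
      ≤ (|t| * b + t ^ 2 * b ^ 2) * t ^ 2 * Var[X; μ] := by
  obtain ⟨ω₀, hω₀⟩ := hb.exists
  have hb0 : 0 ≤ b := (abs_nonneg _).trans hω₀
  have hL : MemLp X 2 μ := by
    refine MemLp.of_bound hX.aestronglyMeasurable b ?_
    filter_upwards [hb] with ω h using by simpa using h
  have hint : Integrable X μ := hL.integrable (by norm_num)
  have hint2 : Integrable (fun ω => X ω ^ 2) μ := hL.integrable_sq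
  have hV : Var[X; μ] = ∫ ω, X ω ^ 2 ∂μ := by
    rw [variance_of_integral_eq_zero hX h0]
  have hVle : Var[X; μ] ≤ b ^ 2 := by
    have := variance_le_sq_of_bounded (a := -b) (b := b)
      (by filter_upwards [hb] with ω h using abs_le.1 h) hX
    calc _ ≤ _ := this
      _ = b ^ 2 := by ring
  have hV0 := variance_nonneg X μ
  have hE : Integrable (fun ω => Complex.exp (((t * X ω : ℝ) : ℂ) * Complex.I)) μ := by
    refine Integrable.of_bound (C := 1) ?_ (ae_of_all _ fun ω => ?_)
    · have : AEMeasurable (fun ω => Complex.exp (((t * X ω : ℝ) : ℂ) * Complex.I)) μ := by fun_prop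
      exact this.aestronglyMeasurable
    · rw [Complex.norm_exp_ofReal_mul_I]
  have hT : Integrable (fun ω => (1 + ((t * X ω : ℝ) : ℂ) * Complex.I
      - (((t * X ω) ^ 2 / 2 : ℝ) : ℂ))) μ := by
    refine Integrable.sub (Integrable.add (integrable_const _) ?_) ?_
    · exact (hint.const_mul t).ofReal.mul_const _
    · refine Integrable.ofReal ?_
      simp only [mul_pow]
      exact (hint2.const_mul _).div_const _
  have hTint : ∫ ω, (1 + ((t * X ω : ℝ) : ℂ) * Complex.I - (((t * X ω) ^ 2 / 2 : ℝ) : ℂ)) ∂μ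
      = ((1 - t ^ 2 * Var[X; μ] / 2 : ℝ) : ℂ) := by
    rw [integral_sub, integral_add (integrable_const _), integral_mul_const,
      integral_complex_ofReal, integral_complex_ofReal, integral_const_mul, h0, hV]
    · simp only [mul_pow, integral_div, integral_const_mul]
      simp
    · exact (hint.const_mul t).ofReal.mul_const _
    · exact (integrable_const _).add ((hint.const_mul t).ofReal.mul_const _)
    · refine Integrable.ofReal ?_
      simp only [mul_pow]
      exact (hint2.const_mul _).div_const _
  have h1 : ‖charFun (μ.map X) t - ((1 - t ^ 2 * Var[X; μ] / 2 : ℝ) : ℂ)‖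
      ≤ |t| * b * t ^ 2 * Var[X; μ] := by
    rw [charFun_apply_real, integral_map hX (by fun_prop), ← hTint]
    have : ∀ ω, Complex.exp ((t : ℂ) * (X ω : ℂ) * Complex.I)
        = Complex.exp (((t * X ω : ℝ) : ℂ) * Complex.I) := fun ω => by push_cast; rfl
    simp only [this]
    rw [← integral_sub hE hT, hV, ← integral_const_mul]
    refine norm_integral_le_of_norm_le (hint2.const_mul _) ?_
    filter_upwards [hb] with ω hω
    have htx : |t * X ω| ≤ |t| * b := by rw [abs_mul]; gcongr
    refine (norm_exp_mul_I_sub_taylor_le (htx.trans ht)).trans ?_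
    calc |t * X ω| ^ 3 = |t * X ω| * (t * X ω) ^ 2 := by rw [← sq_abs (t * X ω)]; ring
      _ ≤ (|t| * b) * (t * X ω) ^ 2 := by gcongr
      _ = _ := by ring
  have h2 : ‖((1 - t ^ 2 * Var[X; μ] / 2 : ℝ) : ℂ) - (Real.exp (-(t ^ 2 * Var[X; μ] / 2)) : ℂ)‖
      ≤ t ^ 2 * b ^ 2 * t ^ 2 * Var[X; μ] := by
    rw [← Complex.ofReal_sub, Complex.norm_real, Real.norm_eq_abs, abs_sub_comm]
    have hs : t ^ 2 * b ^ 2 ≤ 1 := by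
      rw [← sq_abs t, ← mul_pow]; exact pow_le_one₀ (by positivity) ht
    have hts : t ^ 2 * Var[X; μ] ≤ t ^ 2 * b ^ 2 := by gcongr
    have hnn : 0 ≤ t ^ 2 * Var[X; μ] := by positivity
    have := Real.abs_exp_sub_one_sub_id_le (x := -(t ^ 2 * Var[X; μ] / 2))
      (by rw [abs_neg, abs_of_nonneg (by positivity)]; linarith)
    calc _ = |Real.exp (-(t ^ 2 * Var[X; μ] / 2)) - 1 - -(t ^ 2 * Var[X; μ] / 2)| := by
          congr 1; ring
      _ ≤ _ := this
      _ = (t ^ 2 * Var[X; μ]) * (t ^ 2 * Var[X; μ]) / 4 := by ring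
      _ ≤ (t ^ 2 * b ^ 2) * (t ^ 2 * Var[X; μ]) / 4 := by gcongr
      _ ≤ _ := by nlinarith [mul_nonneg (show 0 ≤ t ^ 2 * b ^ 2 by positivity) hnn]
  calc _ ≤ _ := norm_sub_le_norm_sub_add_norm_sub _ _ _
    _ ≤ _ := add_le_add h1 h2
    _ = _ := by ring

end CharFun

section TriangularArray

variable {Ω : ℕ → Type*} [∀ n, MeasurableSpace (Ω n)] {μ : ∀ n, Measure (Ω n)}
  [∀ n, IsProbabilityMeasure (μ n)] {ι : ℕ → Type*} [∀ n, Fintype (ι n)]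
  {X : ∀ n, ι n → Ω n → ℝ}

/-- **Central limit theorem for uniformly small triangular arrays.** The bound `b n → 0` on the
summands of row `n` makes Lindeberg's condition trivial: each characteristic function differs from
the Gaussian one with the same variance by `o(1)` times that variance. -/
theorem tendsto_map_sum_gaussianReal (hX : ∀ n i, AEMeasurable (X n i) (μ n))
    (hindep : ∀ n, iIndepFun (X n) (μ n)) (h0 : ∀ n i, (μ n)[X n i] = 0) {b : ℕ → ℝ}
    (hb : ∀ n i, ∀ᵐ ω ∂μ n, |X n i ω| ≤ b n) (hb0 : Tendsto b atTop (𝓝 0)) {v : NNReal}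
    (hv : Tendsto (fun n => ∑ i, Var[X n i; μ n]) atTop (𝓝 v)) :
    Tendsto (β := ProbabilityMeasure ℝ)
      (fun n => ⟨(μ n).map (fun ω => ∑ i, X n i ω), Measure.isProbabilityMeasure_map
        (Finset.aemeasurable_fun_sum _ fun i _ => hX n i)⟩) atTop
      (𝓝 ⟨gaussianReal 0 v, inferInstance⟩) := by
  refine ProbabilityMeasure.tendsto_iff_tendsto_charFun.2 fun t => ?_
  simp only [ProbabilityMeasure.coe_mk]
  have hg : Tendsto (fun n => ((Real.exp (-(t ^ 2 * (∑ i, Var[X n i; μ n]) / 2)) : ℝ) : ℂ)) atTop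
      (𝓝 (charFun (gaussianReal 0 v) t)) := by
    have : charFun (gaussianReal 0 v) t = ((Real.exp (-(t ^ 2 * v / 2)) : ℝ) : ℂ) := by
      rw [charFun_gaussianReal]; push_cast; congr 1; ring
    rw [this]
    refine (Complex.continuous_ofReal.tendsto _).comp ((Real.continuous_exp.tendsto _).comp ?_)
    exact ((hv.const_mul _).div_const _).neg
  have hdiff : Tendsto (fun n => charFun ((μ n).map (fun ω => ∑ i, X n i ω)) t
      - ((Real.exp (-(t ^ 2 * (∑ i, Var[X n i; μ n]) / 2)) : ℝ) : ℂ)) atTop (𝓝 0) := by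
    have hlim : Tendsto (fun n => (|t| * b n + t ^ 2 * b n ^ 2) * t ^ 2 * ∑ i, Var[X n i; μ n])
        atTop (𝓝 0) := by
      have := (((hb0.const_mul |t|).add ((hb0.pow 2).const_mul (t ^ 2))).mul_const (t ^ 2)).mul hv
      simpa using this
    have hsmall : ∀ᶠ n in atTop, |t| * b n ≤ 1 := by
      have : Tendsto (fun n => |t| * b n) atTop (𝓝 0) := by simpa using hb0.const_mul |t|
      exact (this.eventually (gt_mem_nhds one_pos)).mono fun _ h => h.le
    refine squeeze_zero_norm' ?_ hlim
    filter_upwards [hsmall] with n hn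
    rw [(hindep n).charFun_map_fun_sum_eq_prod (hX n), Finset.prod_apply]
    have hexp : ((Real.exp (-(t ^ 2 * (∑ i, Var[X n i; μ n]) / 2)) : ℝ) : ℂ)
        = ∏ i, ((Real.exp (-(t ^ 2 * Var[X n i; μ n] / 2)) : ℝ) : ℂ) := by
      rw [← Complex.ofReal_prod, ← Real.exp_sum]
      congr 2
      rw [Finset.sum_neg_distrib, Finset.mul_sum, Finset.sum_div]
    rw [hexp, Finset.mul_sum]
    refine (norm_prod_sub_prod_le_sum _ _ _ (fun i _ => ?_) fun i _ => ?_).trans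
      (Finset.sum_le_sum fun i _ => norm_charFun_map_sub_exp_le (hX n i) (hb n i) (h0 n i) hn)
    · have := Measure.isProbabilityMeasure_map (hX n i)
      exact norm_charFun_le_one t
    · rw [Complex.norm_real, Real.norm_of_nonneg (Real.exp_nonneg _), Real.exp_le_one_iff]
      have := variance_nonneg (X n i) (μ n)
      have : 0 ≤ t ^ 2 * Var[X n i; μ n] / 2 := by positivity
      linarith
  simpa using hdiff.add hg

end TriangularArray

/-! ### Convergence in probability to a constant along changing probability spaces -/

section InProbability

variable {Ω : ℕ → Type*} [∀ n, MeasurableSpace (Ω n)] {μ : ∀ n, Measure (Ω n)}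

/-- Convergence in probability of `X n`, defined on a space that depends on `n`, to the constant
`c`. Mathlib's `TendstoInMeasure` needs a single space. Phrased with neighbourhoods, so that it
makes sense in any topological space and is stable under continuous maps. -/
def TendstoInProb {E : Type*} [TopologicalSpace E] (μ : ∀ n, Measure (Ω n)) (X : ∀ n, Ω n → E)
    (c : E) : Prop :=
  ∀ U ∈ 𝓝 c, Tendsto (fun n => μ n {ω | X n ω ∉ U}) atTop (𝓝 0)

namespace TendstoInProb

variable {E F : Type*} [TopologicalSpace E] [TopologicalSpace F]

lemma of_tendsto {x : ℕ → E} {c : E} (h : Tendsto x atTop (𝓝 c)) :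
    TendstoInProb μ (fun n _ => x n) c := by
  intro U hU
  refine tendsto_const_nhds.congr' ?_
  filter_upwards [h hU] with n hn
  have : {ω : Ω n | x n ∉ U} = ∅ := by
    ext; simpa using hn
  rw [this, measure_empty]

lemma comp {X : ∀ n, Ω n → E} {c : E} (h : TendstoInProb μ X c) {f : E → F}
    (hf : ContinuousAt f c) : TendstoInProb μ (fun n ω => f (X n ω)) (f c) :=
  fun _ hU => h _ (hf hU)

lemma prodMk {X : ∀ n, Ω n → E} {Y : ∀ n, Ω n → F} {c : E} {d : F} (hX : TendstoInProb μ X c)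
    (hY : TendstoInProb μ Y d) : TendstoInProb μ (fun n ω => (X n ω, Y n ω)) (c, d) := by
  intro U hU
  obtain ⟨A, hA, B, hB, hAB⟩ := mem_nhds_prod_iff.1 hU
  have h := (hX A hA).add (hY B hB)
  rw [add_zero] at h
  refine tendsto_of_tendsto_of_tendsto_of_le_of_le tendsto_const_nhds h (fun _ => zero_le)
    fun n => (measure_mono ?_).trans (measure_union_le _ _)
  intro ω hω
  by_contra hc
  simp only [Set.mem_union, Set.mem_ofPred_eq, not_or, not_not] at hc
  exact hω (hAB ⟨hc.1, hc.2⟩)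

lemma congr' {X Y : ∀ n, Ω n → E} {c : E} (h : TendstoInProb μ X c)
    (hXY : ∀ᶠ n in atTop, ∀ ω, X n ω = Y n ω) : TendstoInProb μ Y c := by
  intro U hU
  refine (h U hU).congr' ?_
  filter_upwards [hXY] with n hn
  simp only [hn]

lemma add {X Y : ∀ n, Ω n → ℝ} {c d : ℝ} (hX : TendstoInProb μ X c) (hY : TendstoInProb μ Y d) :
    TendstoInProb μ (fun n ω => X n ω + Y n ω) (c + d) :=
  (hX.prodMk hY).comp (f := fun x : ℝ × ℝ => x.1 + x.2) (by fun_prop)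

lemma sub {X Y : ∀ n, Ω n → ℝ} {c d : ℝ} (hX : TendstoInProb μ X c) (hY : TendstoInProb μ Y d) :
    TendstoInProb μ (fun n ω => X n ω - Y n ω) (c - d) :=
  (hX.prodMk hY).comp (f := fun x : ℝ × ℝ => x.1 - x.2) (by fun_prop)

lemma mul {X Y : ∀ n, Ω n → ℝ} {c d : ℝ} (hX : TendstoInProb μ X c) (hY : TendstoInProb μ Y d) :
    TendstoInProb μ (fun n ω => X n ω * Y n ω) (c * d) :=
  (hX.prodMk hY).comp (f := fun x : ℝ × ℝ => x.1 * x.2) (by fun_prop)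

lemma sum {κ : Type*} (s : Finset κ) {X : κ → ∀ n, Ω n → ℝ} {c : κ → ℝ}
    (h : ∀ k ∈ s, TendstoInProb μ (X k) (c k)) :
    TendstoInProb μ (fun n ω => ∑ k ∈ s, X k n ω) (∑ k ∈ s, c k) := by
  classical
  induction s using Finset.induction_on with
  | empty => simpa using of_tendsto tendsto_const_nhds
  | insert a s ha ih =>
    simp only [Finset.sum_insert ha]
    exact (h a (Finset.mem_insert_self a s)).add
      (ih fun k hk => h k (Finset.mem_insert_of_mem hk))

/-- Chebyshev's inequality: convergent means and vanishing variances suffice. -/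
lemma of_variance [∀ n, IsFiniteMeasure (μ n)] {X : ∀ n, Ω n → ℝ} {c : ℝ}
    (hX : ∀ n, MemLp (X n) 2 (μ n)) (hmean : Tendsto (fun n => (μ n)[X n]) atTop (𝓝 c))
    (hvar : Tendsto (fun n => Var[X n; μ n]) atTop (𝓝 0)) : TendstoInProb μ X c := by
  intro U hU
  obtain ⟨ε, hε, hεU⟩ := Metric.mem_nhds_iff.1 hU
  have hlim : Tendsto (fun n => ENNReal.ofReal (Var[X n; μ n] / (ε / 2) ^ 2)) atTop (𝓝 0) := by
    have := ENNReal.tendsto_ofReal (hvar.div_const ((ε / 2) ^ 2))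
    simpa using this
  have hev : ∀ᶠ n in atTop, |(μ n)[X n] - c| < ε / 2 := by
    have := Metric.tendsto_nhds.1 hmean (ε / 2) (half_pos hε)
    simpa [Real.dist_eq] using this
  refine tendsto_of_tendsto_of_tendsto_of_le_of_le' tendsto_const_nhds hlim
    (Eventually.of_forall fun _ => zero_le) ?_
  filter_upwards [hev] with n hn
  refine (measure_mono fun ω hω => ?_).trans
    (meas_ge_le_variance_div_sq (hX n) (half_pos hε))
  by_contra hlt
  refine hω (hεU ?_)
  rw [Set.mem_ofPred_eq, not_le] at hlt
  rw [Metric.mem_ball, Real.dist_eq]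
  calc |X n ω - c| ≤ |X n ω - (μ n)[X n]| + |(μ n)[X n] - c| := abs_sub_le _ _ _
    _ < ε := by linarith

end TendstoInProb

/-- Slutsky's theorem for intervals with random end points: if `T n` converges in distribution to
a law without atoms and `R n` in probability to `r`, then `|T n| ≤ R n` has in the limit the
probability of `[-r, r]`. -/
theorem tendsto_measureReal_abs_le [∀ n, IsProbabilityMeasure (μ n)] {T R : ∀ n, Ω n → ℝ}
    (hT : ∀ n, AEMeasurable (T n) (μ n)) {ν : Measure ℝ}
    [IsProbabilityMeasure ν] [NullSingletonClass ν]
    (hTν : Tendsto (β := ProbabilityMeasure ℝ)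
      (fun n => ⟨(μ n).map (T n), Measure.isProbabilityMeasure_map (hT n)⟩) atTop
      (𝓝 ⟨ν, inferInstance⟩))
    {r : ℝ} (hR : TendstoInProb μ R r) :
    Tendsto (fun n => (μ n).real {ω | |T n ω| ≤ R n ω}) atTop
      (𝓝 (ν.real (Set.Icc (-r) r))) := by
  have hset : ∀ x : ℝ, Tendsto (fun n => (μ n).real {ω | |T n ω| ≤ x}) atTop
      (𝓝 (ν.real (Set.Icc (-x) x))) := by
    intro x
    have hfr : ν (frontier (Set.Icc (-x) x)) = 0 := by
      refine measure_mono_null (t := {-x, x}) ?_ ((Set.toFinite _).measure_zero _)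
      rcases le_or_gt (-x) x with h | h
      · rw [frontier_Icc h]
      · simp [Set.Icc_eq_empty h.not_ge]
    have h := ProbabilityMeasure.tendsto_measure_of_null_frontier_of_tendsto' hTν hfr
    have h2 := (ENNReal.tendsto_toReal (measure_ne_top ν (Set.Icc (-x) x))).comp h
    refine h2.congr fun n => ?_
    simp only [Function.comp_apply, ProbabilityMeasure.coe_mk, Measure.real]
    rw [Measure.map_apply_of_aemeasurable (hT n) measurableSet_Icc]
    congr 2
    ext ω
    simp [abs_le]
  have hcont : ContinuousAt (fun x : ℝ => ν.real (Set.Icc (-x) x)) r := by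
    refine (ENNReal.tendsto_toReal (measure_ne_top _ _)).comp
      (tendsto_measure_of_ae_tendsto_indicator_of_isFiniteMeasure (𝓝 r) measurableSet_Icc
        (fun _ => measurableSet_Icc) ?_)
    -- the indicator of `|y| ≤ x` is locally constant in `x` at `r` unless `|y| = r`
    have hne : ∀ᵐ y ∂ν, |y| ≠ r := by
      have h0 : ν {-r, r} = 0 := (Set.toFinite _).measure_zero _
      filter_upwards [measure_eq_zero_iff_ae_notMem.1 h0] with y hy h
      subst h
      rcases abs_choice y with h | h <;> simp [h] at hy
    filter_upwards [hne] with y hy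
    rcases hy.lt_or_gt with h | h
    · filter_upwards [lt_mem_nhds h] with x hx
      simp [← abs_le, hx.le, h.le]
    · filter_upwards [gt_mem_nhds h] with x hx
      simp [← abs_le, hx.not_ge, h.not_ge]
  have hball : ∀ δ > 0, Tendsto (fun n => (μ n).real {ω | R n ω ∉ Metric.ball r δ}) atTop (𝓝 0) :=
    fun δ hδ => (ENNReal.tendsto_toReal ENNReal.zero_ne_top).comp
      (hR _ (Metric.ball_mem_nhds r hδ))
  have hwin : ∀ U ∈ 𝓝 (ν.real (Set.Icc (-r) r)), ∃ δ > 0,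
      ν.real (Set.Icc (-(r - δ)) (r - δ)) ∈ U ∧
      ν.real (Set.Icc (-(r + δ)) (r + δ)) ∈ U := by
    intro U hU
    obtain ⟨δ, hδ, h⟩ := Metric.mem_nhds_iff.1 (hcont hU)
    refine ⟨δ / 2, half_pos hδ, ?_, ?_⟩
    · refine h (a := r - δ / 2) ?_
      rw [Metric.mem_ball, Real.dist_eq, abs_lt]; constructor <;> linarith
    · refine h (a := r + δ / 2) ?_
      rw [Metric.mem_ball, Real.dist_eq, abs_lt]; constructor <;> linarith
  refine tendsto_order.2 ⟨fun a ha => ?_, fun a ha => ?_⟩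
  · obtain ⟨δ, hδ, h, -⟩ := hwin _ (lt_mem_nhds ha)
    have hlim := (hset (r - δ)).sub (hball δ hδ)
    rw [sub_zero] at hlim
    filter_upwards [hlim.eventually (lt_mem_nhds h)] with n hn
    refine hn.trans_le (sub_le_iff_le_add.2 ((measureReal_mono fun ω hω => ?_).trans
      (measureReal_union_le _ _)))
    by_cases hb : R n ω ∈ Metric.ball r δ
    · refine Or.inl (le_trans (show |T n ω| ≤ r - δ from hω) ?_)
      rw [Metric.mem_ball, Real.dist_eq, abs_lt] at hb
      linarith
    · exact Or.inr hb
  · obtain ⟨δ, hδ, -, h⟩ := hwin _ (gt_mem_nhds ha)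
    have hlim := (hset (r + δ)).add (hball δ hδ)
    rw [add_zero] at hlim
    filter_upwards [hlim.eventually (gt_mem_nhds h)] with n hn
    refine ((measureReal_mono fun ω hω => ?_).trans (measureReal_union_le _ _)).trans_lt hn
    by_cases hb : R n ω ∈ Metric.ball r δ
    · refine Or.inl (le_trans (show |T n ω| ≤ R n ω from hω) ?_)
      rw [Metric.mem_ball, Real.dist_eq, abs_lt] at hb
      linarith
    · exact Or.inr hb

end InProbability

/-! ### The normal quantile -/

lemma le_cdf_stdNormalQuantile {t : ℝ} (ht0 : 0 < t) (ht1 : t < 1) :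
    t ≤ cdf (gaussianReal 0 1) (stdNormalQuantile t) := by
  set F := cdf (gaussianReal 0 1)
  have hne : {s : ℝ | t ≤ F s}.Nonempty := by
    obtain ⟨s, hs⟩ := ((tendsto_cdf_atTop _).eventually (lt_mem_nhds ht1)).exists
    exact ⟨s, hs.le⟩
  have hbdd : BddBelow {s : ℝ | t ≤ F s} := by
    obtain ⟨a, ha⟩ := ((tendsto_cdf_atBot _).eventually (gt_mem_nhds ht0)).exists
    refine ⟨a, fun s hs => le_of_not_gt fun hlt => ?_⟩
    exact absurd (hs.trans (F.mono hlt.le)) ha.not_ge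
  -- right continuity lets the infimum be attained
  refine ge_of_tendsto ((F.right_continuous (stdNormalQuantile t)).tendsto.mono_left
    (nhdsWithin_mono _ Set.Ioi_subset_Ici_self)) ?_
  filter_upwards [self_mem_nhdsWithin] with x hx
  obtain ⟨s, hs, hsx⟩ := exists_lt_of_csInf_lt hne hx
  exact le_trans hs (F.mono hsx.le)

/-- Two-sided coverage, for an interval at least `q √v` wide on either side. -/
lemma le_gaussianReal_Icc {α : ℝ} (hα : α ∈ Set.Ioo (0 : ℝ) (1 / 2)) {v : NNReal} (hv : v ≠ 0)
    {s : ℝ} (hs0 : 0 ≤ s) (hs : (v : ℝ) ≤ s ^ 2) :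
    1 - α ≤ (gaussianReal 0 v).real
      (Set.Icc (-(stdNormalQuantile (1 - α / 2) * s)) (stdNormalQuantile (1 - α / 2) * s)) := by
  obtain ⟨hα0, hα1⟩ := hα
  set q := stdNormalQuantile (1 - α / 2) with hq
  have hcdf : 1 - α / 2 ≤ (gaussianReal 0 1).real (Set.Iic q) := by
    rw [← cdf_eq_real]; exact le_cdf_stdNormalQuantile (by linarith) (by linarith)
  have hsymm : (gaussianReal 0 1).real (Set.Ici (-q)) = (gaussianReal 0 1).real (Set.Iic q) := by
    have h := gaussianReal_map_neg (μ := 0) (v := 1)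
    rw [neg_zero] at h
    conv_lhs => rw [← h]
    rw [map_measureReal_apply measurable_neg measurableSet_Ici]
    congr 1
    ext x
    simp
  have hIcc : 1 - α ≤ (gaussianReal 0 1).real (Set.Icc (-q) q) := by
    have h := measureReal_union_add_inter (μ := gaussianReal 0 1) (s := Set.Iic q)
      (measurableSet_Ici (a := -q))
    have h1 : (gaussianReal 0 1).real (Set.Iic q ∪ Set.Ici (-q)) ≤ 1 := measureReal_le_one
    rw [Set.inter_comm, Set.Ici_inter_Iic, hsymm] at h
    linarith
  -- an empty interval could not have coverage `1 - α > 0`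
  have hq0 : 0 ≤ q := by
    by_contra hlt
    rw [Set.Icc_eq_empty (by linarith), measureReal_empty] at hIcc
    linarith
  have hscale : (gaussianReal 0 v).real (Set.Icc (-(q * √v)) (q * √v))
      = (gaussianReal 0 1).real (Set.Icc (-q) q) := by
    have hv0 : 0 < √(v : ℝ) := Real.sqrt_pos.2 (NNReal.coe_pos.2 (pos_iff_ne_zero.2 hv))
    have h := gaussianReal_map_const_mul (μ := 0) (v := 1) (√(v : ℝ))
    have hvar : NNReal.mk (√(v : ℝ) ^ 2) (sq_nonneg _) * 1 = v := by
      ext; simp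
    rw [hvar, mul_zero] at h
    rw [← h, map_measureReal_apply (measurable_const_mul _) measurableSet_Icc]
    congr 1
    ext x
    simp only [Set.mem_preimage, Set.mem_Icc]
    rw [mul_comm q, ← mul_neg, mul_le_mul_iff_right₀ hv0, mul_le_mul_iff_right₀ hv0]
  have hle : q * √v ≤ q * s := mul_le_mul_of_nonneg_left (Real.sqrt_le_iff.2 ⟨hs0, hs⟩) hq0
  calc 1 - α ≤ _ := hIcc
    _ = _ := hscale.symm
    _ ≤ _ := measureReal_mono (Set.Icc_subset_Icc (neg_le_neg hle) hle)

/-! ### The law of the assignments of a matched set -/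

namespace MatchedStudy

variable {I K : ℕ} (S : MatchedStudy I K)

/-- The probability of the assignment `z` of set `i` under independent treatment of its units. -/
def assignmentProb (i : Fin I) (z : Fin (S.n i) → Bool) : ℝ :=
  ∏ j, if z j then S.e i j else 1 - S.e i j

lemma assignmentProb_pos (i : Fin I) (z : Fin (S.n i) → Bool) : 0 < S.assignmentProb i z := by
  refine Finset.prod_pos fun j _ => ?_
  have h0 := S.propensity_pos i j
  have h1 := S.propensity_lt_one i j
  split_ifs
  · exact h0
  · exact sub_pos.2 h1

/-- The assignment in which unit `j` receives `b` and every other unit the opposite. -/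
def loneAssignment {n : ℕ} (b : Bool) (j : Fin n) : Fin n → Bool := fun k => if k = j then b else !b

lemma loneAssignment_injective {n : ℕ} (b : Bool) :
    Function.Injective (loneAssignment b : Fin n → Fin n → Bool) := by
  intro j k h
  by_contra hjk
  have := congrFun h j
  simp [loneAssignment, hjk] at this

lemma admissible_eq_image_true {i : Fin I} (h : S.m i = 1) :
    S.admissible i = Finset.univ.image (loneAssignment true) := by
  ext z
  simp only [admissible, Finset.mem_filter, Finset.mem_univ, true_and, Finset.mem_image, h,
    Finset.card_eq_one, Finset.ext_iff, Finset.mem_singleton]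
  refine exists_congr fun j => ⟨fun hz => ?_, fun hz k => ?_⟩
  · funext k
    by_cases hk : k = j
    · simpa [loneAssignment, hk] using hz j
    · simpa [loneAssignment, hk] using (hz k).not.2 hk
  · subst hz
    by_cases hk : k = j <;> simp [loneAssignment, hk]

lemma admissible_eq_image_false {i : Fin I} (h : S.m i ≠ 1) :
    S.admissible i = Finset.univ.image (loneAssignment false) := by
  have hmin := S.min_eq_one i
  have hm : S.n i = S.m i + 1 := by omega
  ext z
  have hcard : (Finset.univ.filter fun j => z j = true).card
      + (Finset.univ.filter fun j => z j = false).card = S.n i := by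
    have := Finset.card_filter_add_card_filter_not (s := (Finset.univ : Finset (Fin (S.n i))))
      (fun j => z j = true)
    simpa using this
  have hiff : (Finset.univ.filter fun j => z j = true).card = S.m i
      ↔ (Finset.univ.filter fun j => z j = false).card = 1 := by omega
  simp only [admissible, Finset.mem_filter, Finset.mem_univ, true_and, Finset.mem_image, hiff,
    Finset.card_eq_one, Finset.ext_iff, Finset.mem_singleton]
  refine exists_congr fun j => ⟨fun hz => ?_, fun hz k => ?_⟩
  · funext k
    by_cases hk : k = j
    · simpa [loneAssignment, hk] using hz j
    · simpa [loneAssignment, hk] using (hz k).not.2 hk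
  · subst hz
    by_cases hk : k = j <;> simp [loneAssignment, hk]

lemma assignmentProb_lone_true (i : Fin I) (j : Fin (S.n i)) :
    S.assignmentProb i (loneAssignment true j)
      = S.e i j * ∏ k ∈ Finset.univ.erase j, (1 - S.e i k) := by
  rw [assignmentProb, ← Finset.mul_prod_erase _ _ (Finset.mem_univ j)]
  congr 1
  · simp [loneAssignment]
  · refine Finset.prod_congr rfl fun k hk => ?_
    simp [loneAssignment, Finset.ne_of_mem_erase hk]

lemma assignmentProb_lone_false (i : Fin I) (j : Fin (S.n i)) :
    S.assignmentProb i (loneAssignment false j)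
      = (1 - S.e i j) * ∏ k ∈ Finset.univ.erase j, S.e i k := by
  rw [assignmentProb, ← Finset.mul_prod_erase _ _ (Finset.mem_univ j)]
  congr 1
  · simp [loneAssignment]
  · refine Finset.prod_congr rfl fun k hk => ?_
    simp [loneAssignment, Finset.ne_of_mem_erase hk]

lemma two_le_n (i : Fin I) : 2 ≤ S.n i := by
  have := S.min_eq_one i
  omega

/-- The post-matching probabilities are the probabilities of treatment given the number of treated
units of the set. -/
lemma sum_admissible_ind (i : Fin I) (j : Fin (S.n i)) :
    (∑ z ∈ S.admissible i, S.assignmentProb i z * ind (z j))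
      / ∑ z ∈ S.admissible i, S.assignmentProb i z = S.p i j := by
  by_cases h : S.m i = 1
  · rw [S.admissible_eq_image_true h, Finset.sum_image (loneAssignment_injective _).injOn,
      Finset.sum_image (loneAssignment_injective _).injOn, p, if_pos h]
    simp only [assignmentProb_lone_true]
    congr 1
    rw [Finset.sum_eq_single j]
    · simp [loneAssignment, ind]
    · intro k _ hk
      simp [loneAssignment, ind, hk.symm]
    · simp
  · have hpos : 0 < ∑ z ∈ S.admissible i, S.assignmentProb i z :=
      Finset.sum_pos (fun z _ => S.assignmentProb_pos i z) (S.admissible_nonempty i)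
    rw [S.admissible_eq_image_false h,
      Finset.sum_image (loneAssignment_injective _).injOn] at hpos ⊢
    rw [Finset.sum_image (loneAssignment_injective _).injOn, p, if_neg h]
    simp only [assignmentProb_lone_false] at hpos ⊢
    rw [eq_sub_iff_add_eq, ← add_div, div_eq_one_iff_eq hpos.ne']
    conv_rhs => rw [← Finset.add_sum_erase _ _ (Finset.mem_univ j)]
    rw [← Finset.add_sum_erase _ _ (Finset.mem_univ j)]
    have hj : ind (loneAssignment false j j) = 0 := by simp [loneAssignment, ind]
    rw [hj, mul_zero, zero_add, add_comm]
    congr 1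
    refine Finset.sum_congr rfl fun k hk => ?_
    simp [loneAssignment, ind, (Finset.ne_of_mem_erase hk).symm]

lemma lone_div_sum_mem_Ioo {n : ℕ} (hn : 2 ≤ n) {a : Fin n → ℝ} (ha : ∀ k, 0 < a k) (j : Fin n) :
    a j / ∑ k, a k ∈ Set.Ioo (0 : ℝ) 1 := by
  have hj : 0 < ∑ k ∈ Finset.univ.erase j, a k := by
    refine Finset.sum_pos (fun k _ => ha k) ?_
    rw [← Finset.card_pos, Finset.card_erase_of_mem (Finset.mem_univ j)]
    simp; omega
  rw [← Finset.add_sum_erase _ _ (Finset.mem_univ j)]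
  have := ha j
  refine ⟨by positivity, (div_lt_one (by positivity)).2 (by linarith)⟩

lemma p_mem_Ioo (i : Fin I) (j : Fin (S.n i)) : S.p i j ∈ Set.Ioo (0 : ℝ) 1 := by
  rw [p]
  split_ifs with h
  · exact lone_div_sum_mem_Ioo (S.two_le_n i)
      (a := fun j' => S.e i j' * ∏ k ∈ Finset.univ.erase j', (1 - S.e i k))
      (fun k => by rw [← assignmentProb_lone_true]; exact S.assignmentProb_pos i _) j
  · have := lone_div_sum_mem_Ioo (S.two_le_n i)
      (a := fun j' => (1 - S.e i j') * ∏ k ∈ Finset.univ.erase j', S.e i k)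
      (fun k => by rw [← assignmentProb_lone_false]; exact S.assignmentProb_pos i _) j
    exact ⟨by linarith [this.2], by linarith [this.1]⟩

lemma ippwSet_eq (i : Fin I) (z : Fin (S.n i) → Bool) :
    S.ippwSet i z = (1 / (S.n i : ℝ)) * ∑ j,
      (ind (z j) * (S.Y1 i j / S.p i j) - (1 - ind (z j)) * (S.Y0 i j / (1 - S.p i j))) := by
  rw [ippwSet]
  congr 1
  refine Finset.sum_congr rfl fun j _ => ?_
  cases h : z j <;> simp [ind, Yobs, h]

section Law

variable (P : Measure S.Assignment)

/-- The law of the assignment of set `i` given the number of treated units of this set. -/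
def setLaw (i : Fin I) : Measure (Fin (S.n i) → Bool) :=
  (P.map fun a => a i)[|(S.admissible i : Set (Fin (S.n i) → Bool))]

variable {S P}

lemma map_real_singleton (hcov : S.NoUnobservedCovariates P) (i : Fin I)
    (z : Fin (S.n i) → Bool) : (P.map fun a => a i).real {z} = S.assignmentProb i z := by
  rw [map_measureReal_apply (measurable_pi_apply i) (measurableSet_singleton z)]
  exact hcov i z

variable [IsProbabilityMeasure P]

lemma map_admissible_real (hcov : S.NoUnobservedCovariates P) (i : Fin I) :
    (P.map fun a => a i).real (S.admissible i : Set (Fin (S.n i) → Bool))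
      = ∑ z ∈ S.admissible i, S.assignmentProb i z := by
  have := Measure.isProbabilityMeasure_map (μ := P) (measurable_pi_apply i).aemeasurable
  rw [← sum_measureReal_singleton]
  exact Finset.sum_congr rfl fun z _ => map_real_singleton hcov i z

lemma map_admissible_ne_zero (hcov : S.NoUnobservedCovariates P) (i : Fin I) :
    (P.map fun a => a i) (S.admissible i : Set (Fin (S.n i) → Bool)) ≠ 0 := by
  intro h
  have h1 := map_admissible_real hcov i
  rw [Measure.real, h, ENNReal.toReal_zero] at h1
  exact (Finset.sum_pos (fun z _ => S.assignmentProb_pos i z) (S.admissible_nonempty i)).ne h1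

lemma isProbabilityMeasure_setLaw (hcov : S.NoUnobservedCovariates P) (i : Fin I) :
    IsProbabilityMeasure (S.setLaw P i) := by
  have := Measure.isProbabilityMeasure_map (μ := P) (measurable_pi_apply i).aemeasurable
  exact cond_isProbabilityMeasure (map_admissible_ne_zero hcov i)

lemma setLaw_real_singleton (hcov : S.NoUnobservedCovariates P) (i : Fin I)
    (z : Fin (S.n i) → Bool) : (S.setLaw P i).real {z} =
      if z ∈ S.admissible i then
        S.assignmentProb i z / ∑ z ∈ S.admissible i, S.assignmentProb i z else 0 := by
  rw [setLaw, Measure.real, cond_apply (Finset.measurableSet _), ENNReal.toReal_mul,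
    ENNReal.toReal_inv, ← Measure.real, ← Measure.real, map_admissible_real hcov]
  split_ifs with h
  · rw [Set.inter_eq_right.2 (by simpa using h), map_real_singleton hcov, div_eq_inv_mul]
  · rw [Set.inter_singleton_eq_empty.2 (by simpa using h)]
    simp

lemma integral_setLaw (hcov : S.NoUnobservedCovariates P) (i : Fin I)
    (f : (Fin (S.n i) → Bool) → ℝ) : ∫ z, f z ∂(S.setLaw P i)
      = (∑ z ∈ S.admissible i, S.assignmentProb i z * f z)
        / ∑ z ∈ S.admissible i, S.assignmentProb i z := by
  have := isProbabilityMeasure_setLaw hcov i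
  rw [integral_fintype Integrable.of_finite, Finset.sum_div, ← Finset.sum_filter_add_sum_filter_not
    Finset.univ (fun z => z ∈ S.admissible i)]
  simp only [setLaw_real_singleton hcov, smul_eq_mul]
  rw [Finset.sum_congr rfl (g := fun _ => (0 : ℝ)) (s₁ := Finset.univ.filter fun z => z ∉ _)
    (s₂ := Finset.univ.filter fun z => z ∉ S.admissible i) ?_]
  · rw [Finset.sum_const_zero, add_zero, Finset.filter_mem_eq_inter, Finset.univ_inter]
    refine Finset.sum_congr rfl fun z hz => ?_
    rw [if_pos hz]; ring
  · intro z hz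
    rw [if_neg (Finset.mem_filter.1 hz).2, zero_mul]

/-- Given the matched structure, the assignments of the sets are independent. -/
lemma condLaw_eq_pi (hindep : S.IndependentSets P) (hcov : S.NoUnobservedCovariates P) :
    S.condLaw P = Measure.pi (S.setLaw P) := by
  have hmap : ∀ i, IsProbabilityMeasure (P.map fun a : S.Assignment => a i) := fun i =>
    Measure.isProbabilityMeasure_map (measurable_pi_apply i).aemeasurable
  have := isProbabilityMeasure_setLaw hcov
  have hrect : ∀ t : ∀ i, Set (Fin (S.n i) → Bool),
      P (Set.univ.pi t) = ∏ i, (P.map fun a : S.Assignment => a i) (t i) := by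
    intro t
    have h := (iIndepFun_iff_map_fun_eq_pi_map
      fun i => (measurable_pi_apply i).aemeasurable).1 hindep
    rw [show (fun (a : S.Assignment) i => a i) = id from rfl, Measure.map_id] at h
    conv_lhs => rw [h]
    rw [Measure.pi_pi]
  refine (Measure.pi_eq fun s _ => ?_).symm
  have hev : S.matchedEvent = Set.univ.pi fun i => (S.admissible i : Set _) := by
    ext a; simp [matchedEvent]
  rw [condLaw, cond_apply (Set.toFinite _).measurableSet, hev, hrect, ← Set.pi_inter_distrib,
    hrect, ENNReal.prod_inv_distrib, ← Finset.prod_mul_distrib]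
  · refine Finset.prod_congr rfl fun i _ => ?_
    rw [setLaw, cond_apply (Finset.measurableSet _)]
  · intro i _ j _ _
    exact Or.inl (map_admissible_ne_zero hcov i)

lemma measurePreserving_eval_condLaw (hindep : S.IndependentSets P)
    (hcov : S.NoUnobservedCovariates P) (i : Fin I) :
    MeasurePreserving (fun a : S.Assignment => a i) (S.condLaw P) (S.setLaw P i) := by
  have := isProbabilityMeasure_setLaw hcov
  rw [condLaw_eq_pi hindep hcov]
  exact measurePreserving_eval _ i

lemma isProbabilityMeasure_condLaw (hindep : S.IndependentSets P)
    (hcov : S.NoUnobservedCovariates P) : IsProbabilityMeasure (S.condLaw P) := by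
  have := isProbabilityMeasure_setLaw hcov
  rw [condLaw_eq_pi hindep hcov]
  infer_instance

lemma iIndepFun_condLaw (hindep : S.IndependentSets P) (hcov : S.NoUnobservedCovariates P)
    (f : ∀ i, (Fin (S.n i) → Bool) → ℝ) :
    iIndepFun (fun i (a : S.Assignment) => f i (a i)) (S.condLaw P) := by
  have := isProbabilityMeasure_setLaw hcov
  rw [condLaw_eq_pi hindep hcov]
  exact iIndepFun_pi fun i => Measurable.of_discrete.aemeasurable

lemma integral_condLaw_eval (hindep : S.IndependentSets P) (hcov : S.NoUnobservedCovariates P)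
    (i : Fin I) (f : (Fin (S.n i) → Bool) → ℝ) :
    ∫ a, f (a i) ∂(S.condLaw P) = ∫ z, f z ∂(S.setLaw P i) := by
  rw [← (measurePreserving_eval_condLaw hindep hcov i).map_eq, integral_map
    (measurable_pi_apply i).aemeasurable Measurable.of_discrete.aestronglyMeasurable]

/-- The estimator of a set is conditionally unbiased for the average effect of the set. -/
lemma mu_eq (hindep : S.IndependentSets P) (hcov : S.NoUnobservedCovariates P) (i : Fin I) :
    S.mu P i = (S.n i : ℝ)⁻¹ * ∑ j, (S.Y1 i j - S.Y0 i j) := by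
  have := isProbabilityMeasure_setLaw hcov i
  rw [mu, integral_condLaw_eval hindep hcov]
  simp only [ippwSet_eq]
  rw [integral_const_mul, integral_finsetSum _ fun _ _ => Integrable.of_finite, one_div]
  congr 1
  refine Finset.sum_congr rfl fun j _ => ?_
  have hind : ∫ z, ind (z j) ∂(S.setLaw P i) = S.p i j := by
    rw [integral_setLaw hcov, sum_admissible_ind]
  obtain ⟨h0, h1⟩ := S.p_mem_Ioo i j
  rw [integral_sub Integrable.of_finite Integrable.of_finite, integral_mul_const,
    integral_mul_const, integral_sub Integrable.of_finite Integrable.of_finite, hind]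
  simp only [integral_const, probReal_univ, smul_eq_mul, one_mul]
  rw [mul_div_cancel₀ _ h0.ne', mul_div_cancel₀ _ (sub_pos.2 h1).ne']

/-! ### Range and moments of the estimator of a matched set -/

omit [IsProbabilityMeasure P] in
lemma ae_setLaw_mem_admissible (i : Fin I) : ∀ᵐ z ∂(S.setLaw P i), z ∈ S.admissible i :=
  ae_cond_mem (Finset.measurableSet _)

lemma ae_condLaw_mem_admissible (hindep : S.IndependentSets P)
    (hcov : S.NoUnobservedCovariates P) (i : Fin I) :
    ∀ᵐ a ∂(S.condLaw P), a i ∈ S.admissible i :=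
  (measurePreserving_eval_condLaw hindep hcov i).quasiMeasurePreserving.ae
    (ae_setLaw_mem_admissible i)

omit [IsProbabilityMeasure P] in
lemma ippwSet_mem_Icc {i : Fin I} {z : Fin (S.n i) → Bool} (hz : z ∈ S.admissible i) :
    S.ippwSet i z ∈ Set.Icc (S.ippwMin i) (S.ippwMax i) :=
  ⟨Finset.inf'_le _ hz, Finset.le_sup' _ hz⟩

lemma mu_mem_Icc (hindep : S.IndependentSets P) (hcov : S.NoUnobservedCovariates P) (i : Fin I) :
    S.mu P i ∈ Set.Icc (S.ippwMin i) (S.ippwMax i) := by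
  have := isProbabilityMeasure_condLaw hindep hcov
  have hae : ∀ᵐ a ∂(S.condLaw P), S.ippwSet i (a i) ∈ Set.Icc (S.ippwMin i) (S.ippwMax i) :=
    (ae_condLaw_mem_admissible hindep hcov i).mono fun a ha => ippwSet_mem_Icc ha
  constructor
  · have := integral_mono_ae (integrable_const (S.ippwMin i)) Integrable.of_finite
      (hae.mono fun a ha => ha.1)
    simpa [mu] using this
  · have := integral_mono_ae Integrable.of_finite (integrable_const (S.ippwMax i))
      (hae.mono fun a ha => ha.2)
    simpa [mu] using this

lemma ae_abs_ippwSet_sub_mu_le (hindep : S.IndependentSets P) (hcov : S.NoUnobservedCovariates P)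
    (i : Fin I) : ∀ᵐ a ∂(S.condLaw P), |S.ippwSet i (a i) - S.mu P i| ≤ S.M i := by
  filter_upwards [ae_condLaw_mem_admissible hindep hcov i] with a ha
  have h1 := ippwSet_mem_Icc ha
  have h2 := mu_mem_Icc hindep hcov i
  rw [M, abs_le]
  constructor <;> linarith [h1.1, h1.2, h2.1, h2.2]

omit [IsProbabilityMeasure P] in
lemma l_eq (i : Fin I) : S.l P i = (S.admissible i).inf' (S.admissible_nonempty i)
    fun z => (S.setLaw P i).real {z} := by
  rw [l]
  congr 1
  funext z
  have hA : MeasurableSet {a : S.Assignment | a i ∈ S.admissible i} :=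
    (Set.toFinite _).measurableSet
  rw [setLaw, Measure.real, Measure.real, cond_apply hA, cond_apply (Finset.measurableSet _),
    Measure.map_apply (measurable_pi_apply i) (Finset.measurableSet _),
    Measure.map_apply (measurable_pi_apply i)
      ((Finset.measurableSet _).inter (measurableSet_singleton z))]
  rfl

lemma l_pos (hcov : S.NoUnobservedCovariates P) (i : Fin I) : 0 < S.l P i := by
  rw [l_eq, Finset.lt_inf'_iff]
  intro z hz
  rw [setLaw_real_singleton hcov, if_pos hz]
  exact div_pos (S.assignmentProb_pos i z)
    (Finset.sum_pos (fun z _ => S.assignmentProb_pos i z) (S.admissible_nonempty i))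

omit [IsProbabilityMeasure P] in
lemma l_le {i : Fin I} {z : Fin (S.n i) → Bool} (hz : z ∈ S.admissible i) :
    S.l P i ≤ (S.setLaw P i).real {z} := by
  rw [l_eq]
  exact Finset.inf'_le _ hz

lemma l_le_one (hcov : S.NoUnobservedCovariates P) (i : Fin I) : S.l P i ≤ 1 := by
  have := isProbabilityMeasure_setLaw hcov i
  obtain ⟨z, hz⟩ := S.admissible_nonempty i
  exact (l_le hz).trans measureReal_le_one

lemma nuSq_eq_integral_setLaw (hindep : S.IndependentSets P) (hcov : S.NoUnobservedCovariates P)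
    (i : Fin I) : S.nuSq P i = ∫ z, (S.ippwSet i z - S.mu P i) ^ 2 ∂(S.setLaw P i) := by
  rw [nuSq, variance_eq_integral Measurable.of_discrete.aemeasurable]
  exact integral_condLaw_eval hindep hcov i fun z => (S.ippwSet i z - S.mu P i) ^ 2

/-- Both extreme values of the estimator are taken with probability at least `l i`, and one of
them is at least `M i / 2` away from the mean. -/
lemma l_mul_M_sq_le_nuSq (hindep : S.IndependentSets P) (hcov : S.NoUnobservedCovariates P)
    (i : Fin I) : S.l P i * S.M i ^ 2 ≤ 4 * S.nuSq P i := by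
  have := isProbabilityMeasure_setLaw hcov i
  have hpt : ∀ z ∈ S.admissible i, S.l P i * (S.ippwSet i z - S.mu P i) ^ 2 ≤ S.nuSq P i := by
    intro z hz
    rw [nuSq_eq_integral_setLaw hindep hcov, integral_fintype Integrable.of_finite]
    refine le_trans ?_ (Finset.single_le_sum (a := z) (fun y _ => ?_) (Finset.mem_univ z))
    · exact mul_le_mul_of_nonneg_right (l_le hz) (sq_nonneg _)
    · exact mul_nonneg measureReal_nonneg (sq_nonneg _)
  obtain ⟨x, hx, hmax⟩ := Finset.exists_mem_eq_sup' (S.admissible_nonempty i) (S.ippwSet i)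
  obtain ⟨y, hy, hmin⟩ := Finset.exists_mem_eq_inf' (S.admissible_nonempty i) (S.ippwSet i)
  have h1 := hpt x hx
  have h2 := hpt y hy
  rw [← hmax] at h1
  rw [← hmin] at h2
  have hM : S.M i ^ 2 ≤ 2 * (S.ippwMax i - S.mu P i) ^ 2 + 2 * (S.ippwMin i - S.mu P i) ^ 2 := by
    rw [M]; nlinarith [sq_nonneg (S.ippwMax i - S.mu P i + (S.ippwMin i - S.mu P i))]
  have := mul_le_mul_of_nonneg_left hM (l_pos hcov i).le
  rw [ippwMax, ippwMin] at this
  linarith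

lemma integral_ippwSet_sq (hindep : S.IndependentSets P) (hcov : S.NoUnobservedCovariates P)
    (i : Fin I) :
    ∫ a, S.ippwSet i (a i) ^ 2 ∂(S.condLaw P) = S.nuSq P i + S.mu P i ^ 2 := by
  have := isProbabilityMeasure_condLaw hindep hcov
  rw [nuSq, variance_eq_sub (MemLp.of_discrete), mu]
  simp

lemma integral_ippwSet_pow_four_le (hindep : S.IndependentSets P)
    (hcov : S.NoUnobservedCovariates P) (i : Fin I) :
    ∫ a, S.ippwSet i (a i) ^ 4 ∂(S.condLaw P) ≤ S.ippwMax i ^ 4 + S.ippwMin i ^ 4 := by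
  have := isProbabilityMeasure_condLaw hindep hcov
  have h := integral_mono_ae (μ := S.condLaw P) (f := fun a => S.ippwSet i (a i) ^ 4)
    Integrable.of_finite (integrable_const (S.ippwMax i ^ 4 + S.ippwMin i ^ 4)) ?_
  · simpa using h
  · filter_upwards [ae_condLaw_mem_admissible hindep hcov i] with a ha
    obtain ⟨h1, h2⟩ := ippwSet_mem_Icc ha
    rcases le_total 0 (S.ippwSet i (a i)) with h0 | h0
    · have := pow_le_pow_left₀ h0 h2 4
      have h4 : 0 ≤ S.ippwMin i ^ 4 := by positivity
      linarith
    · have := pow_le_pow_left₀ (neg_nonneg.2 h0) (neg_le_neg h1) 4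
      have h4 : 0 ≤ S.ippwMax i ^ 4 := by positivity
      have e : ∀ x : ℝ, (-x) ^ 4 = x ^ 4 := fun x => by ring
      rw [e, e] at this
      linarith

end Law

/-! ### Matched set weights -/

section Weights

lemma two_mul_le_N : 2 * I ≤ S.N := by
  have := Finset.sum_le_sum fun i (_ : i ∈ Finset.univ) => S.two_le_n i
  simp only [Finset.sum_const, Finset.card_univ, Fintype.card_fin, smul_eq_mul] at this
  rw [N]; omega

lemma w_nonneg (i : Fin I) : 0 ≤ S.w i := by rw [w]; positivity

lemma w_le {C : ℝ} (i : Fin I) (hC : (S.n i : ℝ) ≤ C) : S.w i ≤ C := by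
  have hN : (2 * I : ℝ) ≤ S.N := by exact_mod_cast S.two_mul_le_N
  have hI : (0 : ℝ) < I := by exact_mod_cast i.pos
  rw [w, div_le_iff₀ (by linarith)]
  have hn : (0 : ℝ) ≤ S.n i := by positivity
  nlinarith

lemma n_div_N_eq (i : Fin I) : (S.n i : ℝ) / S.N = (I : ℝ)⁻¹ * S.w i := by
  have hI : (I : ℝ) ≠ 0 := by exact_mod_cast i.pos.ne'
  rw [w]; field_simp

lemma ippw_eq (z : S.Assignment) : S.ippw z = (I : ℝ)⁻¹ * ∑ i, S.w i * S.ippwSet i (z i) := by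
  simp only [ippw, n_div_N_eq, Finset.mul_sum, mul_assoc]

lemma sate_eq {S : MatchedStudy I K} {P : Measure S.Assignment} [IsProbabilityMeasure P]
    (hindep : S.IndependentSets P) (hcov : S.NoUnobservedCovariates P) :
    S.sate = (I : ℝ)⁻¹ * ∑ i, S.w i * S.mu P i := by
  rw [sate, Finset.mul_sum, Finset.mul_sum]
  refine Finset.sum_congr rfl fun i _ => ?_
  have hn : (S.n i : ℝ) ≠ 0 := by have := S.two_le_n i; positivity
  rw [← mul_assoc, ← n_div_N_eq, mu_eq hindep hcov]
  field_simp

end Weights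

end MatchedStudy

/-! ### Averages of triangular arrays -/

/-- The weak law of large numbers for triangular arrays with bounded average second moment. -/
lemma TendstoInProb.average {Ω : ℕ → Type*} [∀ n, MeasurableSpace (Ω n)] {μ : ∀ n, Measure (Ω n)}
    [∀ n, IsProbabilityMeasure (μ n)] {X : ∀ n, Fin n → Ω n → ℝ}
    (hX : ∀ n i, MemLp (X n i) 2 (μ n)) (hindep : ∀ n, iIndepFun (X n) (μ n)) {c B : ℝ}
    (hmean : Tendsto (fun n : ℕ => (n : ℝ)⁻¹ * ∑ i, (μ n)[X n i]) atTop (𝓝 c))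
    (hsq : ∀ᶠ n : ℕ in atTop, (n : ℝ)⁻¹ * ∑ i, ∫ ω, X n i ω ^ 2 ∂μ n ≤ B) :
    TendstoInProb μ (fun n ω => (n : ℝ)⁻¹ * ∑ i, X n i ω) c := by
  refine TendstoInProb.of_variance (fun n => (memLp_finsetSum _ fun i _ => hX n i).const_mul _)
    ?_ ?_
  · refine hmean.congr fun n => ?_
    rw [integral_const_mul, integral_finsetSum _ fun i _ => (hX n i).integrable (by norm_num)]
  · have hlim : Tendsto (fun n : ℕ => (n : ℝ)⁻¹ * B) atTop (𝓝 0) := by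
      simpa using (tendsto_inv_atTop_nhds_zero_nat (𝕜 := ℝ)).mul_const B
    refine squeeze_zero' (Eventually.of_forall fun n => variance_nonneg _ _) ?_ hlim
    filter_upwards [hsq] with n hn
    have hsum : Var[fun ω => ∑ i, X n i ω; μ n] = ∑ i, Var[X n i; μ n] := by
      have := IndepFun.variance_sum (μ := μ n) (s := Finset.univ) (X := X n) (fun i _ => hX n i)
        fun i _ j _ hij => (hindep n).indepFun hij
      rw [← this]
      congr 1
      ext ω
      simp
    rw [variance_const_mul, hsum, sq, mul_assoc]
    refine mul_le_mul_of_nonneg_left (le_trans ?_ hn) (by positivity)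
    gcongr with i
    exact variance_le_expectation_sq (hX n i).aestronglyMeasurable

/-- Weights uniformly close to one do not change the limit of averages. -/
lemma tendsto_average_mul_of_close_to_one {g x : ∀ n : ℕ, Fin n → ℝ} {δ : ℕ → ℝ}
    (hδ : Tendsto δ atTop (𝓝 0)) (hg : ∀ᶠ n in atTop, ∀ i, |g n i - 1| ≤ δ n) {B c : ℝ}
    (hB : ∀ᶠ n : ℕ in atTop, (n : ℝ)⁻¹ * ∑ i, |x n i| ≤ B)
    (hx : Tendsto (fun n : ℕ => (n : ℝ)⁻¹ * ∑ i, x n i) atTop (𝓝 c)) :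
    Tendsto (fun n : ℕ => (n : ℝ)⁻¹ * ∑ i, g n i * x n i) atTop (𝓝 c) := by
  have hdiff : Tendsto (fun n : ℕ => (n : ℝ)⁻¹ * ∑ i, (g n i - 1) * x n i) atTop (𝓝 0) := by
    have hlim : Tendsto (fun n => |δ n| * B) atTop (𝓝 0) := by
      simpa using hδ.abs.mul_const B
    refine squeeze_zero_norm' ?_ hlim
    filter_upwards [hg, hB] with n hgn hBn
    rw [norm_mul, norm_inv, RCLike.norm_natCast]
    calc (n : ℝ)⁻¹ * ‖∑ i, (g n i - 1) * x n i‖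
        ≤ (n : ℝ)⁻¹ * ∑ i, |δ n| * |x n i| := by
          gcongr
          refine (norm_sum_le _ _).trans (Finset.sum_le_sum fun i _ => ?_)
          rw [Real.norm_eq_abs, abs_mul]
          exact mul_le_mul_of_nonneg_right ((hgn i).trans (le_abs_self _)) (abs_nonneg _)
      _ = |δ n| * ((n : ℝ)⁻¹ * ∑ i, |x n i|) := by rw [← Finset.mul_sum]; ring
      _ ≤ |δ n| * B := by gcongr
  have h := hdiff.add hx
  rw [zero_add] at h
  refine h.congr fun n => ?_
  rw [← mul_add, ← Finset.sum_add_distrib]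
  congr 1
  exact Finset.sum_congr rfl fun i _ => by ring

/-! ### The hat matrix of a bounded design -/

section Design

variable {L : ℕ} {Q : (n : ℕ) → Matrix (Fin n) (Fin L) ℝ} {G : Matrix (Fin L) (Fin L) ℝ}

lemma Matrix.tendsto_inv {α 𝕜 m : Type*} [NormedField 𝕜] [Fintype m] [DecidableEq m]
    {l : Filter α} {A : α → Matrix m m 𝕜} {A₀ : Matrix m m 𝕜} (hA : Tendsto A l (𝓝 A₀))
    (h : IsUnit A₀) : Tendsto (fun n => (A n)⁻¹) l (𝓝 A₀⁻¹) := by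
  simp only [Matrix.inv_def, Ring.inverse_eq_inv']
  have hdet : A₀.det ≠ 0 := ((Matrix.isUnit_iff_isUnit_det _).1 h).ne_zero
  have h1 : Tendsto (fun n => (A n).det) l (𝓝 A₀.det) :=
    ((continuous_id.matrix_det).tendsto A₀).comp hA
  have h2 : Tendsto (fun n => (A n).adjugate) l (𝓝 A₀.adjugate) :=
    ((continuous_id.matrix_adjugate).tendsto A₀).comp hA
  exact (h1.inv₀ hdet).smul h2

lemma eventually_hat_eq (hGu : IsUnit G)
    (hG : Tendsto (fun n : ℕ => (n : ℝ)⁻¹ • ((Q n)ᵀ * Q n)) atTop (𝓝 G)) :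
    ∀ᶠ n : ℕ in atTop, MatchedStudy.hat (Q n)
      = (n : ℝ)⁻¹ • (Q n * ((n : ℝ)⁻¹ • ((Q n)ᵀ * Q n))⁻¹ * (Q n)ᵀ) := by
  have hdet : G.det ≠ 0 := ((Matrix.isUnit_iff_isUnit_det _).1 hGu).ne_zero
  have h1 := ((continuous_id.matrix_det).tendsto G).comp hG
  filter_upwards [h1.eventually_ne hdet, eventually_gt_atTop 0] with n hn hpos
  have hn0 : (n : ℝ) ≠ 0 := by positivity
  have hQ : (Q n)ᵀ * Q n = (n : ℝ) • ((n : ℝ)⁻¹ • ((Q n)ᵀ * Q n)) := by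
    rw [smul_smul, mul_inv_cancel₀ hn0, one_smul]
  rw [MatchedStudy.hat]
  conv_lhs => rw [hQ]
  have hinv := Matrix.inv_smul' ((n : ℝ)⁻¹ • ((Q n)ᵀ * Q n)) (Units.mk0 (n : ℝ) hn0)
    (isUnit_iff_ne_zero.2 hn)
  simp only [Units.smul_def, Units.val_mk0, Units.val_inv_eq_inv_val] at hinv
  rw [hinv, Matrix.mul_smul, Matrix.smul_mul]

/-- The leverages of a bounded design tend to zero uniformly, so the rescaling factors
`1 / √(1 - h)` tend to one uniformly. -/
lemma exists_tendsto_leverage_factor {C : ℝ} (hC : ∀ n i k, |Q n i k| ≤ C) (hGu : IsUnit G)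
    (hG : Tendsto (fun n : ℕ => (n : ℝ)⁻¹ • ((Q n)ᵀ * Q n)) atTop (𝓝 G)) :
    ∃ δ : ℕ → ℝ, Tendsto δ atTop (𝓝 0) ∧ ∀ᶠ n in atTop, ∀ i,
      |(√(1 - MatchedStudy.hat (Q n) i i))⁻¹ - 1| ≤ δ n ∧
      |(√(1 - MatchedStudy.hat (Q n) i i))⁻¹ ^ 2 - 1| ≤ δ n := by
  set B : ℕ → Matrix (Fin L) (Fin L) ℝ := fun n => ((n : ℝ)⁻¹ • ((Q n)ᵀ * Q n))⁻¹ with hBdef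
  have hB : Tendsto B atTop (𝓝 G⁻¹) := Matrix.tendsto_inv hG hGu
  set d : ℕ → ℝ := fun n => (n : ℝ)⁻¹ * (C ^ 2 * ∑ k, ∑ l, |B n k l|) with hd
  have hd0 : Tendsto d atTop (𝓝 0) := by
    have hsum : Tendsto (fun n => ∑ k, ∑ l, |B n k l|) atTop (𝓝 (∑ k, ∑ l, |G⁻¹ k l|)) :=
      tendsto_finsetSum _ fun k _ => tendsto_finsetSum _ fun l _ =>
        ((tendsto_pi_nhds.1 (tendsto_pi_nhds.1 hB k)) l).abs
    simpa using (tendsto_inv_atTop_nhds_zero_nat (𝕜 := ℝ)).mul (hsum.const_mul (C ^ 2))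
  refine ⟨fun n => 2 * d n, by simpa using hd0.const_mul 2, ?_⟩
  filter_upwards [eventually_hat_eq hGu hG, hd0.eventually (gt_mem_nhds (show (0 : ℝ) < 1 / 2 by
    norm_num))] with n hn hdn i
  set h := MatchedStudy.hat (Q n) i i with hh
  have hle : |h| ≤ d n := by
    rw [hh, hn, Matrix.smul_apply, smul_eq_mul, abs_mul, abs_of_nonneg (by positivity), hd]
    refine mul_le_mul_of_nonneg_left ?_ (by positivity)
    simp only [Matrix.mul_apply, Matrix.transpose_apply, Finset.sum_mul, Finset.mul_sum]
    rw [Finset.sum_comm]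
    refine (Finset.abs_sum_le_sum_abs _ _).trans (Finset.sum_le_sum fun k _ => ?_)
    refine (Finset.abs_sum_le_sum_abs _ _).trans (Finset.sum_le_sum fun l _ => ?_)
    rw [abs_mul, abs_mul]
    have hC0 : 0 ≤ C := (abs_nonneg _).trans (hC n i k)
    calc |Q n i k| * |B n k l| * |Q n i l| ≤ C * |B n k l| * C := by
          gcongr
          · exact hC n i k
          · exact hC n i l
      _ = _ := by ring
  obtain ⟨hl, hu⟩ := abs_le.1 hle
  have h1h : 1 / 2 < 1 - h := by linarith
  have hsq : |(√(1 - h))⁻¹ ^ 2 - 1| ≤ 2 * d n := by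
    rw [inv_pow, Real.sq_sqrt (by linarith), show (1 - h)⁻¹ - 1 = h / (1 - h) by
      field_simp [show (1 : ℝ) - h ≠ 0 by linarith]; ring, abs_div,
      abs_of_pos (by linarith : 0 < 1 - h),
      div_le_iff₀ (by linarith)]
    have : 0 ≤ d n := (abs_nonneg _).trans hle
    nlinarith
  refine ⟨le_trans ?_ hsq, hsq⟩
  set g := (√(1 - h))⁻¹ with hg
  have hg0 : 0 ≤ g := by positivity
  rw [show g ^ 2 - 1 = (g - 1) * (g + 1) by ring, abs_mul, abs_of_pos (by linarith : 0 < g + 1)]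
  exact le_mul_of_one_le_right (abs_nonneg _) (by linarith)

/-- In the limit, the squared length of the projection on the columns of the design is at most the
squared length. -/
lemma dotProduct_inv_mulVec_le (hGu : IsUnit G)
    (hG : Tendsto (fun n : ℕ => (n : ℝ)⁻¹ • ((Q n)ᵀ * Q n)) atTop (𝓝 G))
    {x : ∀ n : ℕ, Fin n → ℝ} {m : ℝ} {c : Fin L → ℝ}
    (hm : Tendsto (fun n : ℕ => (n : ℝ)⁻¹ * ∑ i, x n i ^ 2) atTop (𝓝 m))
    (hc : ∀ k, Tendsto (fun n : ℕ => (n : ℝ)⁻¹ * ∑ i, x n i * Q n i k) atTop (𝓝 (c k))) :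
    c ⬝ᵥ (G⁻¹ *ᵥ c) ≤ m := by
  -- the limit of the average squared residual `(x - Q β)²` is nonnegative for every `β`;
  -- the least squares coefficient gives the claim
  set β := G⁻¹ *ᵥ c with hβ
  have hGβ : G *ᵥ β = c := by
    rw [hβ, Matrix.mulVec_mulVec, Matrix.mul_nonsing_inv _ ((Matrix.isUnit_iff_isUnit_det _).1 hGu),
      Matrix.one_mulVec]
  have hquad : Tendsto (fun n : ℕ => β ⬝ᵥ (((n : ℝ)⁻¹ • ((Q n)ᵀ * Q n)) *ᵥ β)) atTop
      (𝓝 (β ⬝ᵥ c)) := by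
    rw [← hGβ]
    have hcont : Continuous fun A : Matrix (Fin L) (Fin L) ℝ => β ⬝ᵥ (A *ᵥ β) := by fun_prop
    exact (hcont.tendsto G).comp hG
  have hlin : Tendsto (fun n : ℕ => ∑ k, β k * ((n : ℝ)⁻¹ * ∑ i, x n i * Q n i k)) atTop
      (𝓝 (β ⬝ᵥ c)) :=
    tendsto_finsetSum _ fun k _ => (hc k).const_mul (β k)
  have hres := (hm.sub (hlin.const_mul 2)).add hquad
  have hnn : 0 ≤ m - 2 * (β ⬝ᵥ c) + β ⬝ᵥ c := by
    refine ge_of_tendsto' hres fun n => ?_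
    have h0 : 0 ≤ (n : ℝ)⁻¹ * ∑ i, (x n i - (Q n *ᵥ β) i) ^ 2 := by positivity
    refine h0.trans_eq ?_
    have e1 : ∑ k, β k * ((n : ℝ)⁻¹ * ∑ i, x n i * Q n i k)
        = (n : ℝ)⁻¹ * ∑ i, x n i * (Q n *ᵥ β) i := by
      simp only [Matrix.mulVec, dotProduct, Finset.mul_sum]
      rw [Finset.sum_comm]
      exact Finset.sum_congr rfl fun i _ => Finset.sum_congr rfl fun k _ => by ring
    have e2 : β ⬝ᵥ (((n : ℝ)⁻¹ • ((Q n)ᵀ * Q n)) *ᵥ β) = (n : ℝ)⁻¹ * ∑ i, (Q n *ᵥ β) i ^ 2 := by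
      rw [Matrix.smul_mulVec, dotProduct_smul, smul_eq_mul, ← Matrix.mulVec_mulVec,
        Matrix.dotProduct_mulVec, Matrix.vecMul_transpose]
      simp only [dotProduct, sq]
    rw [e1, e2]
    simp only [sub_sq, Finset.sum_add_distrib, Finset.sum_sub_distrib]
    simp only [mul_assoc, ← Finset.mul_sum]
    ring
  rw [dotProduct_comm]
  linarith

/-- Up to the factor `n`, the variance estimator is an average of squares minus a quadratic form in
`L` averages. -/
lemma MatchedStudy.mul_varEst_eq {n K : ℕ} (S : MatchedStudy n K) {Q : Matrix (Fin n) (Fin L) ℝ}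
    {B : Matrix (Fin L) (Fin L) ℝ} (hQ : hat Q = (n : ℝ)⁻¹ • (Q * B * Qᵀ)) (hn : n ≠ 0)
    (z : S.Assignment) :
    n * S.varEst Q z = (n : ℝ)⁻¹ * ∑ i, (S.w i * S.y Q z i) ^ 2
      - ∑ k, ∑ l, ((n : ℝ)⁻¹ * ∑ i, S.w i * S.y Q z i * Q i k) * B k l
        * ((n : ℝ)⁻¹ * ∑ i, S.w i * S.y Q z i * Q i l) := by
  set u : Fin n → ℝ := fun i => S.w i * S.y Q z i with hu
  have hyW : S.y Q z ᵥ* S.W = u := by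
    funext i; simp [W, Matrix.vecMul_diagonal, hu, mul_comm]
  have hWy : S.W *ᵥ S.y Q z = u := by
    funext i; simp [W, Matrix.mulVec_diagonal, hu]
  have hn0 : (n : ℝ) ≠ 0 := by exact_mod_cast hn
  have hquad : (u ᵥ* (Q * B * Qᵀ)) ⬝ᵥ u
      = ∑ k, ∑ l, (∑ i, u i * Q i k) * B k l * (∑ i, u i * Q i l) := by
    rw [← Matrix.vecMul_vecMul, ← Matrix.dotProduct_mulVec, ← Matrix.vecMul_vecMul,
      Matrix.mulVec_transpose]
    simp only [Matrix.vecMul, dotProduct, Finset.sum_mul]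
    rw [Finset.sum_comm]
  rw [varEst, ← Matrix.vecMul_vecMul, ← Matrix.vecMul_vecMul, hyW, ← Matrix.dotProduct_mulVec, hWy,
    Matrix.vecMul_sub, Matrix.vecMul_one, sub_dotProduct, hQ, Matrix.vecMul_smul, smul_dotProduct,
    hquad]
  have hscale : ∑ k, ∑ l, ((n : ℝ)⁻¹ * ∑ i, u i * Q i k) * B k l * ((n : ℝ)⁻¹ * ∑ i, u i * Q i l)
      = (n : ℝ)⁻¹ ^ 2 * ∑ k, ∑ l, (∑ i, u i * Q i k) * B k l * (∑ i, u i * Q i l) := by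
    refine Eq.trans (Finset.sum_congr rfl fun k _ => ?_) (Finset.mul_sum _ _ _).symm
    refine Eq.trans (Finset.sum_congr rfl fun l _ => ?_) (Finset.mul_sum _ _ _).symm
    ring
  change _ = (n : ℝ)⁻¹ * ∑ i, u i ^ 2 - ∑ k, ∑ l, ((n : ℝ)⁻¹ * ∑ i, u i * Q i k) * B k l
    * ((n : ℝ)⁻¹ * ∑ i, u i * Q i l)
  rw [hscale]
  simp only [dotProduct, smul_eq_mul, ← sq]
  field_simp

end Design

/-! ### Asymptotics of the estimator and of its variance estimator -/

section Asymptotics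

variable {K L : ℕ} {S : (I : ℕ) → MatchedStudy I K} {P : (I : ℕ) → Measure (S I).Assignment}
  [∀ I, IsProbabilityMeasure (P I)] {Q : (I : ℕ) → Matrix (Fin I) (Fin L) ℝ}

/-- No matched set dominates the variance: `l ^ 3 ≤ l` and `l M ^ 2 ≤ 4 ν ^ 2`, so the condition on
extreme sets bounds the largest squared range by `o(I)`. -/
lemma tendsto_inv_mul_iSup_Mtilde_sq (hindep : ∀ I, (S I).IndependentSets (P I))
    (hcov : ∀ I, (S I).NoUnobservedCovariates (P I)) (h1 : NoExtremeSets S P) {v : ℝ}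
    (hv : Tendsto (fun I : ℕ => (I : ℝ)⁻¹ * ∑ i, (S I).w i ^ 2 * (S I).nuSq (P I) i) atTop (𝓝 v)) :
    Tendsto (fun I : ℕ => (I : ℝ)⁻¹ * ⨆ i, (S I).Mtilde i ^ 2) atTop (𝓝 0) := by
  have hlim := h1.mul (hv.const_mul 4)
  rw [zero_mul] at hlim
  refine squeeze_zero (fun I => ?_) (fun I => ?_) hlim
  · exact mul_nonneg (by positivity) (Real.iSup_nonneg fun i => sq_nonneg _)
  · have hl : ∀ i, 0 < (S I).l (P I) i := MatchedStudy.l_pos (hcov I)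
    set D := ∑ i, (S I).l (P I) i ^ 3 * (S I).Mtilde i ^ 2 with hD
    set m := ⨆ i, (S I).Mtilde i ^ 2 with hm
    have hterm : ∀ i, 0 ≤ (S I).l (P I) i ^ 3 * (S I).Mtilde i ^ 2 := fun i =>
      mul_nonneg (pow_nonneg (hl i).le 3) (sq_nonneg _)
    have hm0 : 0 ≤ m := Real.iSup_nonneg fun i => sq_nonneg _
    have hD0 : 0 ≤ D := Finset.sum_nonneg fun i _ => hterm i
    have hmD : m = m / D * D := by
      rcases hD0.eq_or_lt with h | h
      · -- here the quotient is `0 / 0`, but every range vanishes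
        have hz := (Finset.sum_eq_zero_iff_of_nonneg fun i _ => hterm i).1 h.symm
        have hM : ∀ i, (S I).Mtilde i ^ 2 = 0 := fun i =>
          (mul_eq_zero.1 (hz i (Finset.mem_univ i))).resolve_left (pow_pos (hl i) 3).ne'
        have : m = 0 := by rw [hm]; simp only [hM]; exact Real.iSup_const_zero
        rw [this]; simp
      · rw [div_mul_cancel₀ _ h.ne']
    have hDle : D ≤ 4 * ∑ i, (S I).w i ^ 2 * (S I).nuSq (P I) i := by
      rw [hD, Finset.mul_sum]
      refine Finset.sum_le_sum fun i _ => ?_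
      have h3 : (S I).l (P I) i ^ 3 ≤ (S I).l (P I) i := by
        simpa using pow_le_pow_of_le_one (hl i).le (MatchedStudy.l_le_one (hcov I) i)
          (show 1 ≤ 3 by norm_num)
      have hn := MatchedStudy.l_mul_M_sq_le_nuSq (hindep I) (hcov I) i
      calc (S I).l (P I) i ^ 3 * (S I).Mtilde i ^ 2
          ≤ (S I).l (P I) i * (S I).Mtilde i ^ 2 := by gcongr
        _ = (S I).w i ^ 2 * ((S I).l (P I) i * (S I).M i ^ 2) := by
          rw [MatchedStudy.Mtilde]; ring
        _ ≤ (S I).w i ^ 2 * (4 * (S I).nuSq (P I) i) := by gcongr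
        _ = _ := by ring
    calc (I : ℝ)⁻¹ * m = m / D * ((I : ℝ)⁻¹ * D) := by
          conv_lhs => rw [hmD]
          ring
      _ ≤ m / D * ((I : ℝ)⁻¹ * (4 * ∑ i, (S I).w i ^ 2 * (S I).nuSq (P I) i)) := by gcongr
      _ = m / D * (4 * ((I : ℝ)⁻¹ * ∑ i, (S I).w i ^ 2 * (S I).nuSq (P I) i)) := by ring

/-- Asymptotic normality of the oracle estimator. -/
lemma tendsto_map_ippw_sub_sate (hindep : ∀ I, (S I).IndependentSets (P I))
    (hcov : ∀ I, (S I).NoUnobservedCovariates (P I)) (h1 : NoExtremeSets S P) {v : NNReal}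
    (hv : Tendsto (fun I : ℕ => (I : ℝ)⁻¹ * ∑ i, (S I).w i ^ 2 * (S I).nuSq (P I) i) atTop (𝓝 v))
    [∀ I, IsProbabilityMeasure ((S I).condLaw (P I))] :
    Tendsto (β := ProbabilityMeasure ℝ)
      (fun I => ⟨((S I).condLaw (P I)).map fun z => √(I : ℝ) * ((S I).ippw z - (S I).sate),
        Measure.isProbabilityMeasure_map Measurable.of_discrete.aemeasurable⟩) atTop
      (𝓝 ⟨gaussianReal 0 v, inferInstance⟩) := by
  have hsum : ∀ I (z : (S I).Assignment), √(I : ℝ) * ((S I).ippw z - (S I).sate)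
      = ∑ i, (√(I : ℝ))⁻¹ * (S I).w i * ((S I).ippwSet i (z i) - (S I).mu (P I) i) := by
    intro I z
    rw [(S I).ippw_eq, MatchedStudy.sate_eq (hindep I) (hcov I), ← mul_sub,
      ← Finset.sum_sub_distrib, ← mul_assoc, ← div_eq_mul_inv, Real.sqrt_div_self', one_div,
      Finset.mul_sum]
    exact Finset.sum_congr rfl fun i _ => by ring
  have hbd : Tendsto (fun I : ℕ => √((I : ℝ)⁻¹ * ⨆ i, (S I).Mtilde i ^ 2)) atTop (𝓝 0) := by
    have h := (Real.continuous_sqrt.tendsto 0).comp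
      (tendsto_inv_mul_iSup_Mtilde_sq hindep hcov h1 hv)
    rwa [Real.sqrt_zero] at h
  simp only [hsum]
  refine tendsto_map_sum_gaussianReal (μ := fun I => (S I).condLaw (P I))
    (X := fun I i z => (√(I : ℝ))⁻¹ * (S I).w i * ((S I).ippwSet i (z i) - (S I).mu (P I) i))
    (fun I i => Measurable.of_discrete.aemeasurable) (fun I => ?_) (fun I i => ?_)
    (fun I i => ?_) hbd ?_
  · exact MatchedStudy.iIndepFun_condLaw (hindep I) (hcov I) fun i z =>
      (√(I : ℝ))⁻¹ * (S I).w i * ((S I).ippwSet i z - (S I).mu (P I) i)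
  · rw [integral_const_mul, integral_sub Integrable.of_finite (integrable_const _)]
    simp [MatchedStudy.mu]
  · filter_upwards [MatchedStudy.ae_abs_ippwSet_sub_mu_le (hindep I) (hcov I) i] with z hz
    refine Real.le_sqrt_of_sq_le ?_
    rw [sq_abs, mul_pow, mul_pow, inv_pow, Real.sq_sqrt (Nat.cast_nonneg I), mul_assoc]
    refine mul_le_mul_of_nonneg_left ?_ (by positivity)
    refine le_trans ?_ (le_ciSup (f := fun i => (S I).Mtilde i ^ 2) (Set.finite_range _).bddAbove i)
    simp only [MatchedStudy.Mtilde, mul_pow]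
    refine mul_le_mul_of_nonneg_left ?_ (sq_nonneg _)
    rw [← sq_abs]
    exact pow_le_pow_left₀ (abs_nonneg _) hz 2
  · refine hv.congr fun I => ?_
    rw [Finset.mul_sum]
    refine Finset.sum_congr rfl fun i _ => ?_
    rw [variance_const_mul, variance_sub_const Measurable.of_discrete.aestronglyMeasurable, mul_pow,
      inv_pow, Real.sq_sqrt (Nat.cast_nonneg I), mul_assoc]
    rfl

/-- The variance estimator, rescaled, converges in probability to a number that is at least the
asymptotic variance of the oracle estimator: the residual variation of the set means that the
regression does not explain only adds to it. -/
lemma exists_tendstoInProb_mul_varEst (hindep : ∀ I, (S I).IndependentSets (P I))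
    (hcov : ∀ I, (S I).NoUnobservedCovariates (P I)) (h2 : BoundedSetsAndDesign S Q)
    (h3 : BoundedFourthMoments S) (h4 : ConvergentMeans S P Q) {v : ℝ}
    (hv : Tendsto (fun I : ℕ => (I : ℝ)⁻¹ * ∑ i, (S I).w i ^ 2 * (S I).nuSq (P I) i) atTop (𝓝 v)) :
    ∃ s, v ≤ s ∧ TendstoInProb (fun I => (S I).condLaw (P I))
      (fun I z => I * (S I).varEst (Q I) z) s := by
  have hprob : ∀ I, IsProbabilityMeasure ((S I).condLaw (P I)) := fun I =>
    MatchedStudy.isProbabilityMeasure_condLaw (hindep I) (hcov I)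
  obtain ⟨C, hC⟩ := h2
  have hC0 : 0 ≤ C := (Nat.cast_nonneg _).trans (hC 1 0).1
  have hw : ∀ I i, (S I).w i ≤ C := fun I i => (S I).w_le i (hC I i).1
  obtain ⟨C', hC'⟩ := h3
  obtain ⟨m, hm⟩ := h4.mean_sq
  choose c hc using h4.mean_design
  obtain ⟨G, hGu, hG⟩ := h4.design
  obtain ⟨δ, hδ, hgδ⟩ := exists_tendsto_leverage_factor (fun n i k => (hC n i).2 k) hGu hG
  have hinv := Matrix.tendsto_inv hG hGu
  set g : ∀ I, Fin I → ℝ := fun I i => (√(1 - MatchedStudy.hat (Q I) i i))⁻¹ with hg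
  have hg1 : ∀ᶠ I in atTop, ∀ i, |g I i - 1| ≤ δ I := hgδ.mono fun I h i => (h i).1
  have hg2 : ∀ᶠ I in atTop, ∀ i, |g I i ^ 2 - 1| ≤ δ I := hgδ.mono fun I h i => (h i).2
  have hg2le : ∀ᶠ I in atTop, ∀ i, g I i ^ 2 ≤ 2 := by
    filter_upwards [hg2, hδ.eventually (gt_mem_nhds one_pos)] with I h hlt i
    linarith [(abs_le.1 (h i)).2]
  have hsum : Tendsto (fun I : ℕ => (I : ℝ)⁻¹ * ∑ i,
      (S I).w i ^ 2 * ((S I).nuSq (P I) i + (S I).mu (P I) i ^ 2)) atTop (𝓝 (v + m)) := by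
    refine (hv.add hm).congr fun I => ?_
    rw [← mul_add, ← Finset.sum_add_distrib]
    congr 1
    exact Finset.sum_congr rfl fun i _ => by ring
  have hsumB : ∀ᶠ I : ℕ in atTop, (I : ℝ)⁻¹ * ∑ i,
      (S I).w i ^ 2 * ((S I).nuSq (P I) i + (S I).mu (P I) i ^ 2) ≤ v + m + 1 :=
    hsum.eventually_le_const (lt_add_one _)
  have hnu : ∀ I i, 0 ≤ (S I).nuSq (P I) i := fun I i => variance_nonneg _ _
  have hy : ∀ I (z : (S I).Assignment) i, (S I).w i * (S I).y (Q I) z i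
      = g I i * ((S I).w i * (S I).ippwSet i (z i)) := fun I z i => by
    rw [MatchedStudy.y, hg]; ring
  -- the average of squares
  have hA : TendstoInProb (fun I => (S I).condLaw (P I))
      (fun I z => (I : ℝ)⁻¹ * ∑ i, ((S I).w i * (S I).y (Q I) z i) ^ 2) (v + m) := by
    refine TendstoInProb.average (B := 8 * C ^ 4 * C') (fun I i => MemLp.of_discrete) (fun I => ?_)
      ?_ ?_
    · exact MatchedStudy.iIndepFun_condLaw (hindep I) (hcov I) fun i z =>
        ((S I).w i * ((S I).ippwSet i z / √(1 - MatchedStudy.hat (Q I) i i))) ^ 2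
    · have hint : ∀ I i, ∫ z, ((S I).w i * (S I).y (Q I) z i) ^ 2 ∂((S I).condLaw (P I))
          = g I i ^ 2 * ((S I).w i ^ 2 * ((S I).nuSq (P I) i + (S I).mu (P I) i ^ 2)) := by
        intro I i
        simp only [hy, mul_pow, integral_const_mul]
        rw [MatchedStudy.integral_ippwSet_sq (hindep I) (hcov I)]
      simp only [hint]
      refine tendsto_average_mul_of_close_to_one hδ hg2 (B := v + m + 1) ?_ hsum
      filter_upwards [hsumB] with I hI
      refine le_of_eq_of_le ?_ hI
      congr 1
      refine Finset.sum_congr rfl fun i _ => abs_of_nonneg ?_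
      have := hnu I i
      positivity
    · filter_upwards [hg2le] with I hI
      have hterm : ∀ i, ∫ z, (((S I).w i * (S I).y (Q I) z i) ^ 2) ^ 2 ∂((S I).condLaw (P I))
          ≤ 4 * C ^ 4 * ((S I).ippwMax i ^ 4 + (S I).ippwMin i ^ 4) := by
        intro i
        have e : ∀ z, (((S I).w i * (S I).y (Q I) z i) ^ 2) ^ 2
            = (g I i ^ 2) ^ 2 * (S I).w i ^ 4 * (S I).ippwSet i (z i) ^ 4 := fun z => by
          rw [hy]; ring
        simp only [e, integral_const_mul]
        have h4 := MatchedStudy.integral_ippwSet_pow_four_le (hindep I) (hcov I) i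
        have h0 : 0 ≤ ∫ z, (S I).ippwSet i (z i) ^ 4 ∂((S I).condLaw (P I)) :=
          integral_nonneg fun z => by positivity
        have hw4 : (S I).w i ^ 4 ≤ C ^ 4 := pow_le_pow_left₀ ((S I).w_nonneg i) (hw I i) 4
        have hg4 : (g I i ^ 2) ^ 2 ≤ 4 := by
          have := pow_le_pow_left₀ (sq_nonneg (g I i)) (hI i) 2
          linarith
        gcongr
      calc _ ≤ (I : ℝ)⁻¹ * ∑ i, 4 * C ^ 4 * ((S I).ippwMax i ^ 4 + (S I).ippwMin i ^ 4) := by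
            gcongr with i
            exact hterm i
        _ = 4 * C ^ 4 * ((I : ℝ)⁻¹ * ∑ i, (S I).ippwMax i ^ 4
            + (I : ℝ)⁻¹ * ∑ i, (S I).ippwMin i ^ 4) := by
            rw [← Finset.mul_sum, Finset.sum_add_distrib]; ring
        _ ≤ 4 * C ^ 4 * (C' + C') := by
            gcongr
            · exact (hC' I).2.1
            · exact (hC' I).2.2
        _ = _ := by ring
  -- the averages against the columns of the design
  have ha : ∀ k, TendstoInProb (fun I => (S I).condLaw (P I))
      (fun I z => (I : ℝ)⁻¹ * ∑ i, (S I).w i * (S I).y (Q I) z i * Q I i k) (c k) := by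
    intro k
    refine TendstoInProb.average (B := 2 * C ^ 2 * (v + m + 1)) (fun I i => MemLp.of_discrete)
      (fun I => ?_) ?_ ?_
    · exact MatchedStudy.iIndepFun_condLaw (hindep I) (hcov I) fun i z =>
        (S I).w i * ((S I).ippwSet i z / √(1 - MatchedStudy.hat (Q I) i i)) * Q I i k
    · have hint : ∀ I i, ∫ z, (S I).w i * (S I).y (Q I) z i * Q I i k ∂((S I).condLaw (P I))
          = g I i * ((S I).w i * (S I).mu (P I) i * Q I i k) := by
        intro I i
        simp only [hy, integral_mul_const, integral_const_mul]
        rw [MatchedStudy.mu]; ring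
      simp only [hint]
      refine tendsto_average_mul_of_close_to_one hδ hg1 (B := C * (1 + (v + m + 1))) ?_ (hc k)
      filter_upwards [hsumB, eventually_gt_atTop 0] with I hI hpos
      have hI0 : (I : ℝ) ≠ 0 := by positivity
      have hterm : ∀ i, |(S I).w i * (S I).mu (P I) i * Q I i k|
          ≤ C * (1 + (S I).w i ^ 2 * ((S I).nuSq (P I) i + (S I).mu (P I) i ^ 2)) := by
        intro i
        rw [abs_mul, mul_comm]
        have hq := (hC I i).2 k
        have hsq : |(S I).w i * (S I).mu (P I) i|
            ≤ 1 + (S I).w i ^ 2 * ((S I).nuSq (P I) i + (S I).mu (P I) i ^ 2) := by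
          have h0 : 0 ≤ (S I).w i ^ 2 * (S I).nuSq (P I) i :=
            mul_nonneg (sq_nonneg _) (hnu I i)
          nlinarith [sq_nonneg (|(S I).w i * (S I).mu (P I) i| - 1),
            sq_abs ((S I).w i * (S I).mu (P I) i), abs_nonneg ((S I).w i * (S I).mu (P I) i)]
        gcongr
      calc _ ≤ (I : ℝ)⁻¹ * ∑ i, C * (1 + (S I).w i ^ 2
            * ((S I).nuSq (P I) i + (S I).mu (P I) i ^ 2)) := by
            gcongr with i
            exact hterm i
        _ = C * (1 + (I : ℝ)⁻¹ * ∑ i, (S I).w i ^ 2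
            * ((S I).nuSq (P I) i + (S I).mu (P I) i ^ 2)) := by
            rw [← Finset.mul_sum, Finset.sum_add_distrib, Finset.sum_const, Finset.card_univ,
              Fintype.card_fin, nsmul_eq_mul, mul_one, mul_left_comm, mul_add (I : ℝ)⁻¹,
              inv_mul_cancel₀ hI0]
        _ ≤ _ := by gcongr
    · filter_upwards [hg2le, hsumB] with I hI hB
      have hterm : ∀ i, ∫ z, ((S I).w i * (S I).y (Q I) z i * Q I i k) ^ 2 ∂((S I).condLaw (P I))
          ≤ 2 * C ^ 2 * ((S I).w i ^ 2 * ((S I).nuSq (P I) i + (S I).mu (P I) i ^ 2)) := by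
        intro i
        have e : ∀ z, ((S I).w i * (S I).y (Q I) z i * Q I i k) ^ 2
            = g I i ^ 2 * Q I i k ^ 2 * (S I).w i ^ 2 * (S I).ippwSet i (z i) ^ 2 := fun z => by
          rw [hy]; ring
        simp only [e, integral_const_mul]
        rw [MatchedStudy.integral_ippwSet_sq (hindep I) (hcov I), mul_assoc (g I i ^ 2 * _)]
        have hq : Q I i k ^ 2 ≤ C ^ 2 := by
          rw [← sq_abs]; exact pow_le_pow_left₀ (abs_nonneg _) ((hC I i).2 k) 2
        have hgi := hI i
        have := hnu I i
        gcongr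
      calc _ ≤ (I : ℝ)⁻¹ * ∑ i, 2 * C ^ 2 * ((S I).w i ^ 2
            * ((S I).nuSq (P I) i + (S I).mu (P I) i ^ 2)) := by
            gcongr with i
            exact hterm i
        _ = 2 * C ^ 2 * ((I : ℝ)⁻¹ * ∑ i, (S I).w i ^ 2
            * ((S I).nuSq (P I) i + (S I).mu (P I) i ^ 2)) := by
            rw [← Finset.mul_sum]; ring
        _ ≤ _ := by gcongr
  have hproj : c ⬝ᵥ (G⁻¹ *ᵥ c) ≤ m :=
    dotProduct_inv_mulVec_le hGu hG (x := fun I i => (S I).w i * (S I).mu (P I) i)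
      (by simpa only [mul_pow] using hm) hc
  refine ⟨v + m - ∑ k, ∑ l, c k * G⁻¹ k l * c l, ?_, ?_⟩
  · have : ∑ k, ∑ l, c k * G⁻¹ k l * c l = c ⬝ᵥ (G⁻¹ *ᵥ c) := by
      simp only [dotProduct, Matrix.mulVec, Finset.mul_sum, mul_assoc]
    linarith
  · refine (hA.sub (TendstoInProb.sum Finset.univ fun k _ => TendstoInProb.sum Finset.univ
      fun l _ => ((ha k).mul (TendstoInProb.of_tendsto
        ((tendsto_pi_nhds.1 (tendsto_pi_nhds.1 hinv k)) l))).mul (ha l))).congr' ?_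
    filter_upwards [eventually_hat_eq hGu hG, eventually_ne_atTop 0] with I hI hI0 z
    exact ((S I).mul_varEst_eq hI hI0 z).symm

end Asymptotics

/-! ### Coverage of the Wald-type interval -/

theorem theorem1 {K L : ℕ} (S : (I : ℕ) → MatchedStudy I K)
    (P : (I : ℕ) → Measure (S I).Assignment) [∀ I, IsProbabilityMeasure (P I)]
    (Q : (I : ℕ) → Matrix (Fin I) (Fin L) ℝ)
    (α : ℝ) (hα : α ∈ Set.Ioo (0 : ℝ) (1 / 2))
    (hindep : ∀ I, (S I).IndependentSets (P I))
    (hcov : ∀ I, (S I).NoUnobservedCovariates (P I))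
    (h1 : NoExtremeSets S P)
    (h2 : BoundedSetsAndDesign S Q)
    (h3 : BoundedFourthMoments S)
    (h4 : ConvergentMeans S P Q) :
    ∃ c : ℝ, 1 - α ≤ c ∧
      Tendsto (fun I => ((S I).condLaw (P I)).real
        {z | (S I).sate ∈ (S I).waldCI (Q I) (stdNormalQuantile (1 - α / 2)) z})
        atTop (𝓝 c) := by
  have hprob : ∀ I, IsProbabilityMeasure ((S I).condLaw (P I)) := fun I =>
    MatchedStudy.isProbabilityMeasure_condLaw (hindep I) (hcov I)
  obtain ⟨v, hv0, hv⟩ := h4.variance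
  lift v to NNReal using hv0.le
  have hvne : v ≠ 0 := fun h => by simp [h] at hv0
  obtain ⟨s, hvs, hs⟩ := exists_tendstoInProb_mul_varEst hindep hcov h2 h3 h4 hv
  have hs0 : 0 ≤ s := hv0.le.trans hvs
  set q := stdNormalQuantile (1 - α / 2) with hq
  refine ⟨(gaussianReal 0 v).real (Set.Icc (-(q * √s)) (q * √s)), ?_, ?_⟩
  · exact le_gaussianReal_Icc hα hvne (Real.sqrt_nonneg s) (by rwa [Real.sq_sqrt hs0])
  · have hR : TendstoInProb (fun I => (S I).condLaw (P I))
        (fun I z => q * √(I * (S I).varEst (Q I) z)) (q * √s) :=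
      hs.comp (f := fun x => q * √x) (by fun_prop)
    have : NullSingletonClass (gaussianReal 0 v) := nullSingletonClass_gaussianReal hvne
    have hT := tendsto_measureReal_abs_le (μ := fun I => (S I).condLaw (P I))
      (fun I => Measurable.of_discrete.aemeasurable)
      (tendsto_map_ippw_sub_sate hindep hcov h1 hv) hR
    refine hT.congr' ?_
    filter_upwards [eventually_gt_atTop 0] with I hI
    congr 1
    ext z
    have hI0 : 0 < √(I : ℝ) := Real.sqrt_pos.2 (Nat.cast_pos.2 hI)
    rw [Set.mem_ofPred_eq, Set.mem_ofPred_eq, MatchedStudy.waldCI, Set.mem_Icc, abs_mul,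
      abs_of_pos hI0, Real.sqrt_mul (Nat.cast_nonneg I), mul_left_comm, mul_le_mul_iff_right₀ hI0,
      abs_le]
    constructor <;> rintro ⟨h, h'⟩ <;> constructor <;> linarith

end
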